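/- **Theorem 2.** There is an algorithm (a real RAM program that uses unit-cost arithmetic operations and comparisons on real numbers and has no real constants other than natural numbers) and a polynomial $p(m,n)$ such that the following holds for every polytope $P=\mathrm{conv}\{v_1,\dots,v_n\}=\{x\in\mathbb R^d \mid Ax\le b\}$, with $A\in\mathbb R^{m\times d}$ and $b\in\mathbb R^m$. Let $S\in\mathbb R^{m\times n}$, $S_{ij}=b_i-A_iv_j$, be the slack matrix associated to these (possibly redundant) descriptions of $P$. On input $S$ the algorithm halts after at most $p(m,n)$ steps and correctly determines whether $P$ is affinely equivalent to a Cartesian product $P_1\times P_2$ of two polytopes of positive dimension, that is, whether there are such $P_1$, $P_2$ and an affine map that restricts to a bijection from $P$ onto $P_1\times P_2$. In case it is, the algorithm outputs two matrices $S_1,S_2$, with at most $p(m,n)$ entries in total, such that, for some polytopes $P_1,P_2$ of positive dimension for which $P$ is affinely equivalent to $P_1\times P_2$, the matrix $S_i$ is a slack matrix of $P_i$ for $i=1,2$ (a slack matrix of a polytope is one associated, as above, to some pair of descriptions of it). -/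

import Mathlib

/-! ### Polytopes and slack matrices -/

/-- A polytope: the convex hull of finitely many points. -/
def IsPolytope {d : ℕ} (P : Set (Fin d → ℝ)) : Prop :=
  ∃ V : Set (Fin d → ℝ), V.Finite ∧ P = convexHull ℝ V

/-- `S` is a slack matrix of `P`: for some description of `P` as the convex hull of points
`v 0, …, v (n - 1)` and some description of `P` by inequalities `A x ≤ b`, the entry `S i j` is the
slack of the point `v j` in the inequality `i`. Both descriptions may be redundant. -/
def IsSlackMatrix {m n d : ℕ} (S : Matrix (Fin m) (Fin n) ℝ) (P : Set (Fin d → ℝ)) : Prop :=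
  ∃ (v : Fin n → Fin d → ℝ) (A : Matrix (Fin m) (Fin d) ℝ) (b : Fin m → ℝ),
    P = convexHull ℝ (Set.range v) ∧
    P = {x | ∀ i, (A.mulVec x) i ≤ b i} ∧
    ∀ i j, S i j = b i - (A.mulVec (v j)) i

/-- Two sets are affinely equivalent: some affine map between the ambient spaces restricts to a
bijection between them. -/
def AffinelyEquivalent {E F : Type*} [AddCommGroup E] [Module ℝ E] [AddCommGroup F] [Module ℝ F]
    (P : Set E) (Q : Set F) : Prop :=
  ∃ f : E →ᵃ[ℝ] F, Set.BijOn f P Q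

/-- `P` is affinely equivalent to the Cartesian product of the polytopes `P₁` and `P₂`, both of
positive dimension, that is, with more than one point. -/
def IsProductOf {d d₁ d₂ : ℕ} (P : Set (Fin d → ℝ)) (P₁ : Set (Fin d₁ → ℝ))
    (P₂ : Set (Fin d₂ → ℝ)) : Prop :=
  IsPolytope P₁ ∧ IsPolytope P₂ ∧ P₁.Nontrivial ∧ P₂.Nontrivial ∧
    AffinelyEquivalent P (P₁ ×ˢ P₂)

/-! ### Real RAM programs

The memory holds natural numbers (for indices and counters) in variables and in two-dimensional
arrays, and real numbers in two-dimensional arrays. A program is a finite text and refers to finitely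
many variables and arrays, each by a fixed name (a natural number). Natural numbers are only added,
subtracted and compared; real numbers are added, subtracted, multiplied, divided and compared, each
at unit cost. A real number cannot be turned into a natural number other than by comparisons, and
the only constants of a program are natural numbers. -/

namespace RealRAM

/-- The contents of the memory. -/
structure Store where
  /-- the variables that hold natural numbers -/
  var : ℕ → ℕ
  /-- the arrays of natural numbers: name, row, column -/
  nat : ℕ → ℕ → ℕ → ℕ
  /-- the arrays of real numbers: name, row, column -/
  real : ℕ → ℕ → ℕ → ℝ

namespace Store

/-- Assign `k` to the variable `x`. -/
def setVar (s : Store) (x k : ℕ) : Store :=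
  { s with var := fun x' => if x' = x then k else s.var x' }

/-- Write `k` to position `(i, j)` of the array `a` of natural numbers. -/
def setNat (s : Store) (a i j k : ℕ) : Store :=
  { s with nat := fun a' i' j' => if a' = a ∧ i' = i ∧ j' = j then k else s.nat a' i' j' }

/-- Write `r` to position `(i, j)` of the array `a` of real numbers. -/
noncomputable def setReal (s : Store) (a i j : ℕ) (r : ℝ) : Store :=
  { s with real := fun a' i' j' => if a' = a ∧ i' = i ∧ j' = j then r else s.real a' i' j' }

/-- The store at the start of a computation on the `m × n` matrix `S`: variables `0` and `1` hold
`m` and `n`, the real array `0` holds `S`, and everything else is `0`. -/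
noncomputable def input {m n : ℕ} (S : Matrix (Fin m) (Fin n) ℝ) : Store where
  var := fun x => if x = 0 then m else if x = 1 then n else 0
  nat := fun _ _ _ => 0
  real := fun a i j => if h : a = 0 ∧ i < m ∧ j < n then S ⟨i, h.2.1⟩ ⟨j, h.2.2⟩ else 0

/-- The `m × n` matrix that is stored in the real array `a`. -/
def matrix (s : Store) (a m n : ℕ) : Matrix (Fin m) (Fin n) ℝ :=
  fun i j => s.real a i j

end Store

/-- Expressions for natural numbers. -/
inductive NatExpr : Type
  | const (k : ℕ)
  | var (x : ℕ)
  | get (a : ℕ) (i j : NatExpr)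
  | add (e f : NatExpr)
  | sub (e f : NatExpr)

namespace NatExpr

/-- The value of an expression; subtraction is truncated at `0`. -/
def eval (s : Store) : NatExpr → ℕ
  | const k => k
  | var x => s.var x
  | get a i j => s.nat a (i.eval s) (j.eval s)
  | add e f => e.eval s + f.eval s
  | sub e f => e.eval s - f.eval s

/-- The number of steps that the evaluation of an expression takes. -/
def cost : NatExpr → ℕ
  | const _ => 1
  | var _ => 1
  | get _ i j => i.cost + j.cost + 1
  | add e f => e.cost + f.cost + 1
  | sub e f => e.cost + f.cost + 1

end NatExpr

/-- Expressions for real numbers. -/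
inductive RealExpr : Type
  | const (k : ℕ)
  | get (a : ℕ) (i j : NatExpr)
  | add (e f : RealExpr)
  | sub (e f : RealExpr)
  | mul (e f : RealExpr)
  | div (e f : RealExpr)

namespace RealExpr

/-- The value of an expression; a division by `0` returns `0`. -/
noncomputable def eval (s : Store) : RealExpr → ℝ
  | const k => (k : ℝ)
  | get a i j => s.real a (i.eval s) (j.eval s)
  | add e f => e.eval s + f.eval s
  | sub e f => e.eval s - f.eval s
  | mul e f => e.eval s * f.eval s
  | div e f => e.eval s / f.eval s

/-- The number of steps that the evaluation of an expression takes. -/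
def cost : RealExpr → ℕ
  | const _ => 1
  | get _ i j => i.cost + j.cost + 1
  | add e f => e.cost + f.cost + 1
  | sub e f => e.cost + f.cost + 1
  | mul e f => e.cost + f.cost + 1
  | div e f => e.cost + f.cost + 1

end RealExpr

/-- Tests. -/
inductive Test : Type
  | natEq (e f : NatExpr)
  | natLt (e f : NatExpr)
  | realEq (e f : RealExpr)
  | realLt (e f : RealExpr)
  | not (b : Test)
  | and (b c : Test)

namespace Test

/-- The test succeeds. -/
def Holds (s : Store) : Test → Prop
  | natEq e f => e.eval s = f.eval s
  | natLt e f => e.eval s < f.eval s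
  | realEq e f => e.eval s = f.eval s
  | realLt e f => e.eval s < f.eval s
  | not b => ¬ b.Holds s
  | and b c => b.Holds s ∧ c.Holds s

/-- The number of steps that a test takes. -/
def cost : Test → ℕ
  | natEq e f => e.cost + f.cost + 1
  | natLt e f => e.cost + f.cost + 1
  | realEq e f => e.cost + f.cost + 1
  | realLt e f => e.cost + f.cost + 1
  | not b => b.cost + 1
  | and b c => b.cost + c.cost + 1

end Test

/-- Programs. -/
inductive Program : Type
  | skip
  | setVar (x : ℕ) (e : NatExpr)
  | setNat (a : ℕ) (i j : NatExpr) (e : NatExpr)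
  | setReal (a : ℕ) (i j : NatExpr) (e : RealExpr)
  | seq (c₁ c₂ : Program)
  | ite (b : Test) (c₁ c₂ : Program)
  | loop (b : Test) (c : Program)

/-- `Runs c s s' t`: the program `c`, started with memory `s`, halts after exactly `t` steps with
memory `s'`. Here `loop b c` repeats `c` as long as the test `b`, made before each pass,
succeeds. -/
inductive Runs : Program → Store → Store → ℕ → Prop
  | skip (s : Store) : Runs .skip s s 1
  | setVar (s : Store) (x : ℕ) (e : NatExpr) :
      Runs (.setVar x e) s (s.setVar x (e.eval s)) (e.cost + 1)
  | setNat (s : Store) (a : ℕ) (i j : NatExpr) (e : NatExpr) :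
      Runs (.setNat a i j e) s (s.setNat a (i.eval s) (j.eval s) (e.eval s))
        (i.cost + j.cost + e.cost + 1)
  | setReal (s : Store) (a : ℕ) (i j : NatExpr) (e : RealExpr) :
      Runs (.setReal a i j e) s (s.setReal a (i.eval s) (j.eval s) (e.eval s))
        (i.cost + j.cost + e.cost + 1)
  | seq {c₁ c₂ : Program} {s s' s'' : Store} {t t' : ℕ} :
      Runs c₁ s s' t → Runs c₂ s' s'' t' → Runs (.seq c₁ c₂) s s'' (t + t')
  | iteTrue {b : Test} {c₁ c₂ : Program} {s s' : Store} {t : ℕ} :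
      b.Holds s → Runs c₁ s s' t → Runs (.ite b c₁ c₂) s s' (b.cost + t + 1)
  | iteFalse {b : Test} {c₁ c₂ : Program} {s s' : Store} {t : ℕ} :
      ¬ b.Holds s → Runs c₂ s s' t → Runs (.ite b c₁ c₂) s s' (b.cost + t + 1)
  | loopDone {b : Test} {c : Program} {s : Store} :
      ¬ b.Holds s → Runs (.loop b c) s s (b.cost + 1)
  | loopStep {b : Test} {c : Program} {s s' s'' : Store} {t t' : ℕ} :
      b.Holds s → Runs c s s' t → Runs (.loop b c) s' s'' t' →
      Runs (.loop b c) s s'' (b.cost + t + 1 + t')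

/-- Programs are deterministic: the final memory and the number of steps are determined by the
program and the initial memory. -/
theorem Runs.unique {c : Program} {s s₁ s₂ : Store} {t₁ t₂ : ℕ}
    (h₁ : Runs c s s₁ t₁) (h₂ : Runs c s s₂ t₂) : s₁ = s₂ ∧ t₁ = t₂ := by
  induction h₁ generalizing s₂ t₂ with
  | skip => cases h₂; exact ⟨rfl, rfl⟩
  | setVar => cases h₂; exact ⟨rfl, rfl⟩
  | setNat => cases h₂; exact ⟨rfl, rfl⟩
  | setReal => cases h₂; exact ⟨rfl, rfl⟩
  | seq _ _ ih ih' =>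
    cases h₂ with
    | seq k k' =>
      obtain ⟨rfl, rfl⟩ := ih k
      obtain ⟨rfl, rfl⟩ := ih' k'
      exact ⟨rfl, rfl⟩
  | iteTrue hb _ ih =>
    cases h₂ with
    | iteTrue _ k => obtain ⟨rfl, rfl⟩ := ih k; exact ⟨rfl, rfl⟩
    | iteFalse hb' _ => exact absurd hb hb'
  | iteFalse hb _ ih =>
    cases h₂ with
    | iteTrue hb' _ => exact absurd hb' hb
    | iteFalse _ k => obtain ⟨rfl, rfl⟩ := ih k; exact ⟨rfl, rfl⟩
  | loopDone hb =>
    cases h₂ with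
    | loopDone _ => exact ⟨rfl, rfl⟩
    | loopStep hb' _ _ => exact absurd hb' hb
  | loopStep hb _ _ ih ih' =>
    cases h₂ with
    | loopDone hb' => exact absurd hb hb'
    | loopStep _ k k' =>
      obtain ⟨rfl, rfl⟩ := ih k
      obtain ⟨rfl, rfl⟩ := ih' k'
      exact ⟨rfl, rfl⟩

/-- The answer that a halted computation leaves in memory: variable `0` holds `1` for "yes" and `0`
for "no". -/
def Store.answer (s : Store) : ℕ := s.var 0

/-- The first output matrix: its format is in the variables `1` and `2`, its entries in the real
array `1`. -/
def Store.output₁ (s : Store) : Matrix (Fin (s.var 1)) (Fin (s.var 2)) ℝ :=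
  s.matrix 1 (s.var 1) (s.var 2)

/-- The second output matrix: its format is in the variables `3` and `4`, its entries in the real
array `2`. -/
def Store.output₂ (s : Store) : Matrix (Fin (s.var 3)) (Fin (s.var 4)) ℝ :=
  s.matrix 2 (s.var 3) (s.var 4)

/-- The number of entries of the two output matrices. -/
def Store.outputSize (s : Store) : ℕ := s.var 1 * s.var 2 + s.var 3 * s.var 4

end RealRAM

/-!
The map that takes a point of `P` to its slacks is affine and injective, so `P` may be recovered
from `S`: up to affine equivalence it is the convex hull of the columns. The nonconstant rows
whose zero sets are maximal correspond to facets, and they already determine `P`.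

On a product `P₁ × P₂`, the slack of a facet depends on one of the two coordinates only: otherwise
the face on which its restriction to some `P₁ × {q}` is minimal would lie in a facet with a larger
zero set. Hence the facet rows split into two parts such that, with one column, the part of another
column may be exchanged without leaving the affine hull of the columns. In other words, the set `X`
of the rows of one factor is a separator of the direction `C` of this affine hull: restriction to
`X` maps `C` to itself. Conversely, if `X` is a separator, then two points of `P` can be glued to
one with the slacks of the first in the rows of `X` and those of the second in the other rows. So
`P` is the product of the convex hulls of the two parts of the columns, and these parts are slack
matrices of the factors.

To find the separators, let `Q` be the matrix of the orthogonal projection onto `C`. Restriction to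
`X` commutes with `Q` if and only if `Q i j = 0` whenever exactly one of `i` and `j` is in `X`.
Therefore the separators are the unions of connected components of the support of `Q`, and `P` is a
product if and only if two facet rows lie in different components. The matrix `Q` is computed by the
Gram-Schmidt process without square roots.
-/

/-! ### Affine functionals on convex hulls -/

section ConvexHull

variable {E : Type*} [AddCommGroup E] [Module ℝ E] {s : Set E}

theorem le_apply_of_mem_convexHull {f : E →ᵃ[ℝ] ℝ} {r : ℝ} (hf : ∀ y ∈ s, r ≤ f y) {x : E}
    (hx : x ∈ convexHull ℝ s) : r ≤ f x :=
  convexHull_min hf ((convex_Ici r).affine_preimage f) hx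

theorem apply_eq_of_mem_face_convexHull {f g : E →ᵃ[ℝ] ℝ} {r t : ℝ} (hf : ∀ y ∈ s, r ≤ f y)
    (hg : ∀ y ∈ s, f y = r → g y = t) {x : E} (hx : x ∈ convexHull ℝ s) (hfx : f x = r) :
    g x = t := by
  suffices hconv : Convex ℝ {y | r ≤ f y ∧ (f y = r → g y = t)} from
    (convexHull_min (fun y hy => And.intro (hf y hy) (hg y hy)) hconv hx).2 hfx
  refine convex_iff_forall_pos.2 fun y ⟨hy, hgy⟩ z ⟨hz, hgz⟩ a b ha hb hab => ?_
  simp only [Set.mem_ofPred_eq, Convex.combo_affine_apply hab, smul_eq_mul]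
  have hr : r = a * r + b * r := by rw [← add_mul, hab, one_mul]
  refine ⟨hr ▸ add_le_add (mul_le_mul_of_nonneg_left hy ha.le)
    (mul_le_mul_of_nonneg_left hz hb.le), fun h => ?_⟩
  have hyr : f y = r := by nlinarith
  have hzr : f z = r := by nlinarith
  rw [hgy hyr, hgz hzr, ← add_mul, hab, one_mul]

theorem exists_mem_convexHull_forall_lt (hs : s.Finite) (hne : s.Nonempty) :
    ∃ y ∈ convexHull ℝ s, ∀ (f : E →ᵃ[ℝ] ℝ) (r : ℝ), (∀ x ∈ s, r ≤ f x) →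
      (∃ x ∈ s, r < f x) → r < f y := by
  lift s to Finset E using hs
  have hcard : (0 : ℝ) < s.card := Nat.cast_pos.2 (Finset.card_pos.2 hne)
  refine ⟨s.centroid ℝ id, by simpa using s.centroid_mem_convexHull hne, fun f r hf hlt => ?_⟩
  have hw := s.sum_centroidWeights_eq_one_of_nonempty ℝ hne
  rw [Finset.centroid_def, Finset.map_affineCombination _ _ _ hw,
    Finset.affineCombination_eq_linear_combination _ _ _ hw]
  simp only [Finset.centroidWeights_apply, Function.comp_apply, id, smul_eq_mul]
  rw [← Finset.mul_sum, lt_inv_mul_iff₀ hcard, ← nsmul_eq_mul, ← Finset.sum_const]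
  exact Finset.sum_lt_sum hf hlt

end ConvexHull

theorem exists_lineMap_eq_zero {ι : Type*} [Finite ι] {a b : ι → ℝ} (ha : ∀ i, 0 ≤ a i)
    (hab : ∀ i, b i < 0 → 0 < a i) (hb : ∃ i, b i < 0) :
    ∃ r ∈ Set.Ioo (0 : ℝ) 1, (∀ i, 0 ≤ AffineMap.lineMap (a i) (b i) r) ∧
      ∃ i, b i < 0 ∧ AffineMap.lineMap (a i) (b i) r = 0 := by
  obtain ⟨k, hk : b k < 0, hmin⟩ :=
    Set.exists_min_image {i | b i < 0} (fun i => a i / (a i - b i)) (Set.toFinite _) hb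
  have hd : 0 < a k - b k := by linarith [ha k]
  have hr : a k / (a k - b k) < 1 := by rw [div_lt_one hd]; linarith
  refine ⟨a k / (a k - b k), ⟨div_pos (hab k hk) hd, hr⟩, fun i => ?_, k, hk, ?_⟩
  · rw [AffineMap.lineMap_apply_ring']
    rcases lt_or_ge (b i) 0 with hi | hi
    · have := hmin i hi
      rw [le_div_iff₀ (by linarith [ha i])] at this
      linarith
    · nlinarith [ha i, div_pos (hab k hk) hd]
  · rw [AffineMap.lineMap_apply_ring']
    field_simp
    ring

/-! ### Facet rows of a matrix -/

section FacetRow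

variable {ι κ : Type*}

/-- The row `i` of `S` takes two different values. -/
def NonconstRow (S : Matrix ι κ ℝ) (i : ι) : Prop :=
  ∃ j j', S i j ≠ S i j'

/-- The set of columns in which the row `i` of `S` vanishes: the vertices of the face of a polytope
that its `i`-th inequality defines, if `S` is a slack matrix. -/
def zeroSet (S : Matrix ι κ ℝ) (i : ι) : Set κ :=
  {j | S i j = 0}

/-- The combinatorial counterpart of an inequality that defines a facet: a nonconstant row whose
zero set is maximal among those of the nonconstant rows. -/
def IsFacetRow (S : Matrix ι κ ℝ) (i : ι) : Prop :=
  MaximalFor (NonconstRow S) (zeroSet S) i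

/-- The set of all facet rows of `S`. -/
def facetRows (S : Matrix ι κ ℝ) : Set ι :=
  {i | IsFacetRow S i}

theorem NonconstRow.exists_isFacetRow [Finite ι] {S : Matrix ι κ ℝ} {k : ι}
    (hk : NonconstRow S k) : ∃ i, IsFacetRow S i ∧ zeroSet S k ⊆ zeroSet S i := by
  obtain ⟨i, ⟨hi, hki⟩, hmax⟩ :=
    (Set.toFinite {i | NonconstRow S i ∧ zeroSet S k ⊆ zeroSet S i}).exists_maximalFor
      (zeroSet S) _ ⟨k, hk, subset_rfl⟩
  exact ⟨i, ⟨hi, fun l hl hil => hmax ⟨hl, hki.trans hil⟩ hil⟩, hki⟩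

/-- The matrix `S` with its rows outside of `Y` replaced by `0`; the format is kept, so that a
program need not renumber the rows. -/
noncomputable def rowsIn (S : Matrix ι κ ℝ) (Y : Set ι) : Matrix ι κ ℝ :=
  Matrix.of fun i j => Y.indicator (fun i => S i j) i

end FacetRow

/-! ### Slack maps -/

section SlackMap

variable {ι κ E : Type*} [AddCommGroup E] [Module ℝ E]

/-- A coordinate-free slack matrix: the affine functionals `T i` describe the convex hull of the
points `v j` within their affine hull, and `S` holds their values at these points. -/
structure IsSlackMap (S : Matrix ι κ ℝ) (v : κ → E) (T : ι → E →ᵃ[ℝ] ℝ) : Prop where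
  apply_eq : ∀ i j, T i (v j) = S i j
  nonneg : ∀ i j, 0 ≤ S i j
  mem : ∀ x ∈ affineSpan ℝ (Set.range v), (∀ i, 0 ≤ T i x) → x ∈ convexHull ℝ (Set.range v)

namespace IsSlackMap

variable {S : Matrix ι κ ℝ} {v : κ → E} {T : ι → E →ᵃ[ℝ] ℝ}

theorem nonneg_apply (h : IsSlackMap S v T) (i : ι) : ∀ x ∈ Set.range v, 0 ≤ T i x := by
  rintro _ ⟨j, rfl⟩
  exact (h.nonneg i j).trans_eq (h.apply_eq i j).symm

theorem nonneg_of_mem (h : IsSlackMap S v T) (i : ι) {x : E}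
    (hx : x ∈ convexHull ℝ (Set.range v)) : 0 ≤ T i x :=
  le_apply_of_mem_convexHull (h.nonneg_apply i) hx

theorem nonneg_of_not_nonconstRow (h : IsSlackMap S v T) {i : ι} (hi : ¬ NonconstRow S i)
    {x : E} (hx : x ∈ affineSpan ℝ (Set.range v)) : 0 ≤ T i x := by
  obtain ⟨_, j, rfl⟩ := (affineSpan_nonempty ℝ).1 ⟨x, hx⟩
  have hconst : Set.EqOn (T i) (AffineMap.const ℝ E (S i j)) (Set.range v) := by
    rintro _ ⟨j', rfl⟩
    by_contra hne
    exact hi ⟨j', j, by rwa [h.apply_eq] at hne⟩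
  rw [AffineMap.eqOn_affineSpan hconst hx]
  exact h.nonneg i j

theorem exists_pos [Finite κ] [Nonempty κ] (h : IsSlackMap S v T) :
    ∃ y ∈ convexHull ℝ (Set.range v), ∀ i, NonconstRow S i → 0 < T i y := by
  obtain ⟨y, hy, hpos⟩ :=
    exists_mem_convexHull_forall_lt (Set.finite_range v) (Set.range_nonempty v)
  refine ⟨y, hy, fun i ⟨j, j', hne⟩ => hpos (T i) 0 (h.nonneg_apply i) ?_⟩
  simp only [Set.exists_range_iff, h.apply_eq]
  by_contra! hle
  have hzero : ∀ l, S i l = 0 := fun l => (hle l).antisymm (h.nonneg i l)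
  exact hne ((hzero j).trans (hzero j').symm)

theorem eventually_lineMap_mem [Finite ι] (h : IsSlackMap S v T) {x y : E}
    (hy : y ∈ affineSpan ℝ (Set.range v)) (hpos : ∀ i, NonconstRow S i → 0 < T i y)
    (hx : x ∈ affineSpan ℝ (Set.range v)) :
    ∀ᶠ r : ℝ in nhds 0, AffineMap.lineMap y x r ∈ convexHull ℝ (Set.range v) := by
  have hev : ∀ᶠ r : ℝ in nhds 0, ∀ i, NonconstRow S i → 0 < T i (AffineMap.lineMap y x r) := by
    refine Filter.eventually_all.2 fun i => Filter.eventually_imp_distrib_left.2 fun hi => ?_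
    simp only [AffineMap.apply_lineMap]
    exact AffineMap.lineMap_continuous.continuousAt.eventually_const_lt
      (by simpa using hpos i hi)
  filter_upwards [hev] with r hr
  have hmem := AffineMap.lineMap_mem r hy hx
  exact h.mem _ hmem fun i => (em (NonconstRow S i)).elim (fun hi => (hr i hi).le)
    fun hi => h.nonneg_of_not_nonconstRow hi hmem

theorem exists_nonconstRow_eq_zero [Finite ι] (h : IsSlackMap S v T) (a : E →ᵃ[ℝ] ℝ) {y x : E}
    (hy : y ∈ convexHull ℝ (Set.range v)) (hx : x ∈ affineSpan ℝ (Set.range v))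
    (hmin : ∀ z ∈ Set.range v, a y ≤ a z) (hyx : a y < a x) :
    ∃ k, NonconstRow S k ∧ T k y = 0 := by
  by_contra! hne
  have hev := h.eventually_lineMap_mem (convexHull_subset_affineSpan _ hy)
    (fun i hi => (h.nonneg_of_mem i hy).lt_of_ne' (hne i hi)) hx
  obtain ⟨r, hmem, hr : r < 0⟩ := ((hev.filter_mono nhdsWithin_le_nhds).and
    (self_mem_nhdsWithin (s := Set.Iio (0 : ℝ)))).exists
  have hle := le_apply_of_mem_convexHull hmin hmem
  rw [AffineMap.apply_lineMap, AffineMap.lineMap_apply_ring'] at hle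
  nlinarith

theorem exists_row_of_face [Finite ι] [Finite κ] (h : IsSlackMap S v T) (a : E →ᵃ[ℝ] ℝ)
    {j₀ j₁ : κ} (hmin : ∀ j, a (v j₀) ≤ a (v j)) (hne : a (v j₁) ≠ a (v j₀)) :
    ∃ k, NonconstRow S k ∧ ∀ j, a (v j) = a (v j₀) → S k j = 0 := by
  let J : Set E := {x ∈ Set.range v | a x = a (v j₀)}
  have hJ : J.Finite := (Set.finite_range v).subset (Set.sep_subset _ _)
  obtain ⟨y, hyJ, hlt⟩ := exists_mem_convexHull_forall_lt hJ ⟨v j₀, ⟨j₀, rfl⟩, rfl⟩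
  have hy : y ∈ convexHull ℝ (Set.range v) := convexHull_mono (Set.sep_subset _ _) hyJ
  have hay : a y = a (v j₀) :=
    apply_eq_of_mem_face_convexHull (f := AffineMap.const ℝ E 0) (fun _ _ => le_rfl)
      (fun _ hx _ => hx.2) hyJ rfl
  obtain ⟨k, hk, hky⟩ := h.exists_nonconstRow_eq_zero a hy (subset_affineSpan ℝ _ ⟨j₁, rfl⟩)
    (by rintro _ ⟨j, rfl⟩; exact hay ▸ hmin j) (hay ▸ (hmin j₁).lt_of_ne' hne)
  refine ⟨k, hk, fun j hj => ?_⟩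
  by_contra hSkj
  refine (hlt (T k) 0 (fun x hx => h.nonneg_apply k x hx.1) ⟨v j, ⟨⟨j, rfl⟩, hj⟩, ?_⟩).ne' hky
  rw [h.apply_eq]
  exact (h.nonneg k j).lt_of_ne' hSkj

theorem mem_of_facetRows [Finite ι] [Finite κ] (h : IsSlackMap S v T) {x : E}
    (hx : x ∈ affineSpan ℝ (Set.range v)) (hF : ∀ i, IsFacetRow S i → 0 ≤ T i x) :
    x ∈ convexHull ℝ (Set.range v) := by
  obtain ⟨_, j, -⟩ := (affineSpan_nonempty ℝ).1 ⟨x, hx⟩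
  have : Nonempty κ := ⟨j⟩
  obtain ⟨y, hy, hpos⟩ := h.exists_pos
  have hnonconst : ∀ i, T i x < 0 → NonconstRow S i := fun i hi => by
    by_contra hi'
    exact hi.not_ge (h.nonneg_of_not_nonconstRow hi' hx)
  by_contra hnot
  obtain ⟨r, ⟨hr0, hr1⟩, hnonneg, k, hk, hzero⟩ :=
    exists_lineMap_eq_zero (fun i => h.nonneg_of_mem i hy)
      (fun i hi => hpos i (hnonconst i hi)) (by by_contra! hx0; exact hnot (h.mem x hx hx0))
  simp only [← AffineMap.apply_lineMap] at hnonneg hzero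
  have hz := h.mem _ (AffineMap.lineMap_mem r (convexHull_subset_affineSpan _ hy) hx) hnonneg
  obtain ⟨i, hi, hki⟩ := (hnonconst k hk).exists_isFacetRow
  have hzi : T i (AffineMap.lineMap y x r) = 0 := by
    refine apply_eq_of_mem_face_convexHull (h.nonneg_apply k) ?_ hz hzero
    rintro _ ⟨l, rfl⟩ hl
    rw [h.apply_eq] at hl ⊢
    exact hki hl
  rw [AffineMap.apply_lineMap, AffineMap.lineMap_apply_ring'] at hzi
  nlinarith [hpos i hi.prop, hF i hi]

theorem eq_of_facetRows [Finite ι] [Finite κ] (h : IsSlackMap S v T) {x x' : E}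
    (hx : x ∈ convexHull ℝ (Set.range v)) (hx' : x' ∈ affineSpan ℝ (Set.range v))
    (hF : ∀ i, IsFacetRow S i → T i x = T i x') : x = x' := by
  have hline : ∀ r : ℝ, AffineMap.lineMap x x' r ∈ convexHull ℝ (Set.range v) := fun r =>
    h.mem_of_facetRows (AffineMap.lineMap_mem r (convexHull_subset_affineSpan _ hx) hx')
      fun i hi => by
        rw [AffineMap.apply_lineMap, ← hF i hi, AffineMap.lineMap_same_apply]
        exact h.nonneg_of_mem i hx
  rw [← sub_eq_zero, ← Module.forall_dual_apply_eq_zero_iff ℝ]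
  intro f
  by_contra hne
  obtain ⟨b, hb⟩ := (Set.finite_range (f ∘ v)).bddBelow
  have hle : b ≤ f.toAffineMap (AffineMap.lineMap x x' ((f x - b + 1) / f (x - x'))) :=
    le_apply_of_mem_convexHull
      (by rintro _ ⟨j, rfl⟩; exact hb ⟨j, rfl⟩) (hline _)
  rw [AffineMap.apply_lineMap, AffineMap.lineMap_apply_ring'] at hle
  simp only [LinearMap.coe_toAffineMap, map_sub] at hle hne
  rw [← neg_sub (f x) (f x'), mul_neg, div_mul_cancel₀ _ hne] at hle
  linarith

end IsSlackMap

end SlackMap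

/-! ### Separators -/

section Separator

variable {ι : Type*}

/-- A separator of a space `C` of vectors, in the sense of matroid theory: a set `X` of coordinates
such that `C` is the direct sum of its projections to `X` and to the complement of `X`. -/
def IsSeparator (C : Submodule ℝ (ι → ℝ)) (X : Set ι) : Prop :=
  ∀ c ∈ C, X.indicator c ∈ C

theorem IsSeparator.compl {C : Submodule ℝ (ι → ℝ)} {X : Set ι} (hX : IsSeparator C X) :
    IsSeparator C Xᶜ := fun c hc => by
  rw [Set.indicator_compl]
  exact C.sub_mem hc (hX c hc)

theorem isSeparator_span {s : Set (ι → ℝ)} {X : Set ι}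
    (h : ∀ c ∈ s, X.indicator c ∈ Submodule.span ℝ s) : IsSeparator (Submodule.span ℝ s) X := by
  intro c hc
  induction hc using Submodule.span_induction with
  | mem c hc => exact h c hc
  | zero => simp
  | add c c' _ _ hc hc' => exact (Set.indicator_add X c c').symm ▸ Submodule.add_mem _ hc hc'
  | smul r c _ hc => exact (Set.indicator_const_smul X r c).symm ▸ Submodule.smul_mem _ r hc

end Separator

section FacetSpace

variable {ι κ E : Type*} [AddCommGroup E] [Module ℝ E]

/-- The direction of the affine hull of the columns of `S`, of which only the facet rows are kept.
Its separators correspond to the ways to write a polytope with slack matrix `S` as a product. -/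
noncomputable def facetSpace (S : Matrix ι κ ℝ) : Submodule ℝ (ι → ℝ) :=
  vectorSpan ℝ (Set.range (rowsIn S (facetRows S)).col)

/-- The functionals `T i` combined to one affine map, those with `i` outside of `Y` replaced by
`0`. -/
noncomputable def rowMap (T : ι → E →ᵃ[ℝ] ℝ) (Y : Set ι) : E →ᵃ[ℝ] (ι → ℝ) :=
  AffineMap.pi (Y.indicator T)

theorem rowMap_of_mem (T : ι → E →ᵃ[ℝ] ℝ) {Y : Set ι} {i : ι} (hi : i ∈ Y) (x : E) :
    rowMap T Y x i = T i x := by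
  simp [rowMap, hi]

theorem rowMap_of_notMem (T : ι → E →ᵃ[ℝ] ℝ) {Y : Set ι} {i : ι} (hi : i ∉ Y) (x : E) :
    rowMap T Y x i = 0 := by
  simp [rowMap, hi]

namespace IsSlackMap

variable {S : Matrix ι κ ℝ} {v : κ → E} {T : ι → E →ᵃ[ℝ] ℝ}

theorem rowMap_comp (h : IsSlackMap S v T) (Y : Set ι) : rowMap T Y ∘ v = (rowsIn S Y).col := by
  ext j i
  by_cases hi : i ∈ Y
  · simp [rowMap_of_mem T hi, rowsIn, hi, h.apply_eq]
  · simp [rowMap_of_notMem T hi, rowsIn, hi]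

theorem facetSpace_eq (h : IsSlackMap S v T) :
    facetSpace S = (vectorSpan ℝ (Set.range v)).map (rowMap T (facetRows S)).linear := by
  rw [AffineMap.map_vectorSpan, facetSpace, ← h.rowMap_comp, Set.range_comp]

theorem rowMap_sub_mem_facetSpace (h : IsSlackMap S v T) {x x' : E}
    (hx : x ∈ affineSpan ℝ (Set.range v)) (hx' : x' ∈ affineSpan ℝ (Set.range v)) :
    rowMap T (facetRows S) x - rowMap T (facetRows S) x' ∈ facetSpace S := by
  rw [h.facetSpace_eq, ← vsub_eq_sub, ← AffineMap.linearMap_vsub]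
  exact Submodule.mem_map_of_mem (vsub_mem_vectorSpan_of_mem_affineSpan_of_mem_affineSpan hx hx')

theorem exists_glue_of_isSeparator (h : IsSlackMap S v T) {X : Set ι}
    (hX : IsSeparator (facetSpace S) X) {x₁ x₂ : E} (h₁ : x₁ ∈ affineSpan ℝ (Set.range v))
    (h₂ : x₂ ∈ affineSpan ℝ (Set.range v)) :
    ∃ x ∈ affineSpan ℝ (Set.range v), (∀ i ∈ facetRows S ∩ X, T i x = T i x₁) ∧
      ∀ i ∈ facetRows S ∩ Xᶜ, T i x = T i x₂ := by
  have hc := hX _ (h.rowMap_sub_mem_facetSpace h₁ h₂)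
  rw [h.facetSpace_eq] at hc
  obtain ⟨u, hu, huc⟩ := hc
  have hval : rowMap T (facetRows S) (u +ᵥ x₂) =
      X.indicator (rowMap T (facetRows S) x₁ - rowMap T (facetRows S) x₂) +
        rowMap T (facetRows S) x₂ := by
    rw [AffineMap.map_vadd, huc, vadd_eq_add]
  refine ⟨u +ᵥ x₂, vadd_mem_affineSpan_of_mem_affineSpan_of_mem_vectorSpan h₂ hu,
    fun i ⟨hi, hiX⟩ => ?_, fun i ⟨hi, hiX⟩ => ?_⟩
  · simpa [rowMap_of_mem T hi, hiX] using congrFun hval i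
  · simpa [rowMap_of_mem T hi, Set.indicator_of_notMem hiX] using congrFun hval i

end IsSlackMap

end FacetSpace

/-! ### The facet rows of a Cartesian product -/

section Product

variable {E₁ E₂ : Type*} [AddCommGroup E₁] [Module ℝ E₁] [AddCommGroup E₂] [Module ℝ E₂]

theorem affineMap_prod_add_apply_prod (f : E₁ × E₂ →ᵃ[ℝ] ℝ) (x x' : E₁) (y y' : E₂) :
    f (x, y) + f (x', y') = f (x, y') + f (x', y) := by
  have hsub : f (x, y) - f (x', y) = f (x, y') - f (x', y') := by
    simp only [← vsub_eq_sub, ← AffineMap.linearMap_vsub]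
    simp
  linarith

namespace IsSlackMap

variable {ι κ : Type*} [Finite ι] [Finite κ] {S : Matrix ι κ ℝ} {v : κ → E₁ × E₂}
  {T : ι → E₁ × E₂ →ᵃ[ℝ] ℝ} {Q₁ : Set E₁} {Q₂ : Set E₂}

theorem forall_fst_eq_or_forall_snd_eq (h : IsSlackMap S v T)
    (hQ : convexHull ℝ (Set.range v) = Q₁ ×ˢ Q₂) {i : ι} (hi : IsFacetRow S i) :
    (∀ x ∈ Q₁, ∀ x' ∈ Q₁, ∀ y ∈ Q₂, T i (x, y) = T i (x', y)) ∨
      ∀ x ∈ Q₁, ∀ y ∈ Q₂, ∀ y' ∈ Q₂, T i (x, y) = T i (x, y') := by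
  have hmem : ∀ j, (v j).1 ∈ Q₁ ∧ (v j).2 ∈ Q₂ := fun j => by
    rw [← Set.mem_prod, ← hQ]
    exact subset_convexHull ℝ _ ⟨j, rfl⟩
  have hpair : ∀ {x y}, x ∈ Q₁ → y ∈ Q₂ → (x, y) ∈ convexHull ℝ (Set.range v) :=
    fun hx hy => hQ ▸ Set.mk_mem_prod hx hy
  have hexch := affineMap_prod_add_apply_prod (T i)
  obtain ⟨j, -, -⟩ := hi.prop
  have : Nonempty κ := ⟨j⟩
  let q := (v j).2
  have hq : q ∈ Q₂ := (hmem j).2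
  let a : E₁ × E₂ →ᵃ[ℝ] ℝ := (T i).comp (AffineMap.fst.prod (AffineMap.const ℝ _ q))
  obtain ⟨j₀, hmin⟩ := Finite.exists_min fun l => a (v l)
  by_cases hconst : ∀ l, a (v l) = a (v j₀)
  · have ha : ∀ z ∈ convexHull ℝ (Set.range v), a z = a (v j₀) := fun z hz =>
      apply_eq_of_mem_face_convexHull (f := AffineMap.const ℝ _ (0 : ℝ)) (fun _ _ => le_rfl)
        (by rintro _ ⟨l, rfl⟩ -; exact hconst l) hz rfl
    refine .inl fun x hx x' hx' y _ => ?_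
    have hax : T i (x, q) = T i (x', q) := (ha _ (hpair hx hq)).trans (ha _ (hpair hx' hq)).symm
    linarith [hexch x x' y q]
  · obtain ⟨l, hl⟩ := not_forall.1 hconst
    obtain ⟨k, hk, hface⟩ := h.exists_row_of_face a hmin hl
    have hsub : zeroSet S i ⊆ zeroSet S k := fun l (hl : S i l = 0) => by
      refine hface l ((hmin l).antisymm' ?_)
      have h0 := h.nonneg_of_mem i (hpair (hmem j₀).1 (hmem l).2)
      have hTl : T i ((v l).1, (v l).2) = 0 := (h.apply_eq i l).trans hl
      change T i ((v l).1, q) ≤ T i ((v j₀).1, q)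
      linarith [hexch (v l).1 (v j₀).1 (v l).2 q]
    have hzero : ∀ y ∈ Q₂, T i ((v j₀).1, y) = 0 := fun y hy =>
      apply_eq_of_mem_face_convexHull (f := a) (by rintro _ ⟨l, rfl⟩; exact hmin l)
        (by rintro _ ⟨l, rfl⟩ hl; exact (h.apply_eq i l).trans (hi.2 hk hsub (hface l hl)))
        (hpair (hmem j₀).1 hy) rfl
    refine .inr fun x _ y hy y' hy' => ?_
    linarith [hexch x (v j₀).1 y y', hzero y hy, hzero y' hy']

theorem exists_isSeparator_of_prod (h : IsSlackMap S v T)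
    (hQ : convexHull ℝ (Set.range v) = Q₁ ×ˢ Q₂) :
    ∃ X : Set ι, IsSeparator (facetSpace S) X ∧
      (∀ i ∈ facetRows S ∩ X, ∀ x ∈ Q₁, ∀ y ∈ Q₂, ∀ y' ∈ Q₂, T i (x, y) = T i (x, y')) ∧
      ∀ i ∈ facetRows S ∩ Xᶜ, ∀ x ∈ Q₁, ∀ x' ∈ Q₁, ∀ y ∈ Q₂, T i (x, y) = T i (x', y) := by
  let X : Set ι := {i | ∀ x ∈ Q₁, ∀ y ∈ Q₂, ∀ y' ∈ Q₂, T i (x, y) = T i (x, y')}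
  have hX : ∀ i ∈ facetRows S ∩ Xᶜ, ∀ x ∈ Q₁, ∀ x' ∈ Q₁, ∀ y ∈ Q₂, T i (x, y) = T i (x', y) :=
    fun i hi => (h.forall_fst_eq_or_forall_snd_eq hQ hi.1).resolve_right hi.2
  refine ⟨X, isSeparator_span ?_, fun i hi => hi.2, hX⟩
  rintro _ ⟨_, ⟨j, rfl⟩, _, ⟨j', rfl⟩, rfl⟩
  have hv : ∀ l, v l ∈ convexHull ℝ (Set.range v) := fun l => subset_convexHull ℝ _ ⟨l, rfl⟩
  have hmem : ∀ l, (v l).1 ∈ Q₁ ∧ (v l).2 ∈ Q₂ := fun l => Set.mem_prod.1 (hQ ▸ hv l)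
  have hmix : ((v j).1, (v j').2) ∈ convexHull ℝ (Set.range v) :=
    hQ ▸ Set.mk_mem_prod (hmem j).1 (hmem j').2
  suffices heq : X.indicator ((rowsIn S (facetRows S)).col j - (rowsIn S (facetRows S)).col j') =
      rowMap T (facetRows S) ((v j).1, (v j').2) - rowMap T (facetRows S) (v j') from
    heq ▸ h.rowMap_sub_mem_facetSpace (convexHull_subset_affineSpan _ hmix)
      (convexHull_subset_affineSpan _ (hv j'))
  rw [← h.rowMap_comp]
  ext i
  by_cases hi : i ∈ facetRows S
  · by_cases hiX : i ∈ X
    · simp [hiX, rowMap_of_mem T hi, hiX _ (hmem j).1 _ (hmem j').2 _ (hmem j).2]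
    · simp [hiX, rowMap_of_mem T hi, hX i ⟨hi, hiX⟩ _ (hmem j).1 _ (hmem j').1 _ (hmem j').2]
  · simp [Set.indicator, rowMap_of_notMem T hi]

theorem exists_mem_facetRows_of_prod (h : IsSlackMap S v T)
    (hQ : convexHull ℝ (Set.range v) = Q₁ ×ˢ Q₂) {X : Set ι} {z z' : E₁ × E₂}
    (hz : z ∈ Q₁ ×ˢ Q₂) (hz' : z' ∈ Q₁ ×ˢ Q₂) (hne : z ≠ z')
    (hX : ∀ i ∈ facetRows S ∩ Xᶜ, T i z = T i z') : ∃ i ∈ X, IsFacetRow S i := by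
  by_contra! hnone
  rw [← hQ] at hz hz'
  exact hne (h.eq_of_facetRows hz (convexHull_subset_affineSpan _ hz') fun i hi =>
    hX i ⟨hi, fun hiX => hnone i hiX hi⟩)

theorem exists_facet_separator_of_prod (h : IsSlackMap S v T)
    (hQ : convexHull ℝ (Set.range v) = Q₁ ×ˢ Q₂) (h₁ : Q₁.Nontrivial) (h₂ : Q₂.Nontrivial) :
    ∃ X : Set ι, IsSeparator (facetSpace S) X ∧
      (∃ i ∈ X, IsFacetRow S i) ∧ ∃ i ∉ X, IsFacetRow S i := by
  obtain ⟨X, hsep, hin, hout⟩ := h.exists_isSeparator_of_prod hQ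
  obtain ⟨x, hx, x', hx', hxx'⟩ := h₁
  obtain ⟨y, hy, y', hy', hyy'⟩ := h₂
  refine ⟨X, hsep,
    h.exists_mem_facetRows_of_prod hQ (Set.mk_mem_prod hx hy) (Set.mk_mem_prod hx' hy) ?_ ?_,
    h.exists_mem_facetRows_of_prod hQ (Set.mk_mem_prod hx hy) (Set.mk_mem_prod hx hy') ?_ ?_⟩
  · simpa using hxx'
  · exact fun i hi => hout i hi x hx x' hx' y hy
  · simpa using hyy'
  · exact fun i hi => hin i ⟨hi.1, not_not.1 hi.2⟩ x hx y hy y' hy'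

end IsSlackMap

end Product

/-! ### Change of coordinates -/

section Coordinates

variable {𝕜 E F : Type*} [Field 𝕜] [AddCommGroup E] [Module 𝕜 E] [AddCommGroup F] [Module 𝕜 F]
  {s : Set E}

theorem exists_affineMap_leftInverse {f : E →ᵃ[𝕜] F} (hf : Set.InjOn f (affineSpan 𝕜 s)) :
    ∃ g : F →ᵃ[𝕜] E, ∀ x ∈ affineSpan 𝕜 s, g (f x) = x := by
  rcases s.eq_empty_or_nonempty with rfl | ⟨o, ho⟩
  · exact ⟨AffineMap.const 𝕜 F 0, fun x hx =>
      absurd (AffineSubspace.span_empty 𝕜 E E ▸ hx) (AffineSubspace.notMem_bot 𝕜 E x)⟩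
  replace ho := subset_affineSpan 𝕜 s ho
  have hker : LinearMap.ker (f.linear.domRestrict (vectorSpan 𝕜 s)) = ⊥ := by
    refine LinearMap.ker_eq_bot'.2 fun u (hu : f.linear u = 0) => ?_
    have heq : (u : E) +ᵥ o = o :=
      hf (vadd_mem_affineSpan_of_mem_affineSpan_of_mem_vectorSpan ho u.2) ho
        (by rw [AffineMap.map_vadd, hu, zero_vadd])
    simpa using heq
  obtain ⟨g, hg⟩ := LinearMap.exists_leftInverse_of_injective _ hker
  refine ⟨((vectorSpan 𝕜 s).subtype ∘ₗ g).toAffineMap.comp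
    (AffineMap.id 𝕜 F - AffineMap.const 𝕜 F (f o)) + AffineMap.const 𝕜 F o, fun x hx => ?_⟩
  have hxo : (g (f x - f o) : E) = x - o := by
    rw [← vsub_eq_sub, ← f.linearMap_vsub]
    exact congrArg Subtype.val (LinearMap.congr_fun hg
      ⟨x -ᵥ o, vsub_mem_vectorSpan_of_mem_affineSpan_of_mem_affineSpan hx ho⟩)
  simp [-map_sub, hxo]

theorem exists_affineMap_injOn_affineSpan_image_eq_top (hs : s.Nonempty)
    [FiniteDimensional 𝕜 (vectorSpan 𝕜 s)] :
    ∃ (d : ℕ) (f : E →ᵃ[𝕜] (Fin d → 𝕜)), Set.InjOn f (affineSpan 𝕜 s) ∧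
      affineSpan 𝕜 (f '' s) = ⊤ := by
  obtain ⟨p, hp⟩ :=
    LinearMap.exists_leftInverse_of_injective _ (vectorSpan 𝕜 s).ker_subtype
  have hpV : ∀ u : vectorSpan 𝕜 s, p u = u := LinearMap.congr_fun hp
  let e := (Module.finBasis 𝕜 (vectorSpan 𝕜 s)).equivFun
  refine ⟨_, (e.toLinearMap ∘ₗ p).toAffineMap, fun x hx y hy hxy => ?_, ?_⟩
  · have hxy' : p (x -ᵥ y) = 0 := by
      simpa [sub_eq_zero] using hxy
    have := hpV ⟨_, vsub_mem_vectorSpan_of_mem_affineSpan_of_mem_affineSpan hx hy⟩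
    rw [hxy'] at this
    simpa [sub_eq_zero] using congrArg Subtype.val this.symm
  · have hmap : (vectorSpan 𝕜 s).map p = ⊤ := eq_top_iff.2 fun u _ => ⟨u, u.2, hpV u⟩
    rw [AffineSubspace.affineSpan_eq_top_iff_vectorSpan_eq_top_of_nonempty _ _ _ (hs.image _),
      ← AffineMap.map_vectorSpan, LinearMap.toAffineMap_linear, Submodule.map_comp, hmap,
      Submodule.map_top, LinearEquiv.range]

end Coordinates

namespace IsSlackMap

variable {ι κ E F : Type*} [AddCommGroup E] [Module ℝ E] [AddCommGroup F] [Module ℝ F]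
  {S : Matrix ι κ ℝ} {v : κ → E} {T : ι → E →ᵃ[ℝ] ℝ}

theorem injOn_affineSpan [Finite ι] [Finite κ] (h : IsSlackMap S v T) {f : E →ᵃ[ℝ] F}
    (hf : Set.InjOn f (convexHull ℝ (Set.range v))) :
    Set.InjOn f (affineSpan ℝ (Set.range v)) := by
  intro x hx x' hx' hxx'
  obtain ⟨_, j, -⟩ := (affineSpan_nonempty ℝ).1 ⟨x, hx⟩
  have : Nonempty κ := ⟨j⟩
  obtain ⟨y, hy, hpos⟩ := h.exists_pos
  have hya := convexHull_subset_affineSpan _ hy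
  obtain ⟨r, ⟨hr, hr'⟩, hr0 : 0 < r⟩ := ((((h.eventually_lineMap_mem hya hpos hx).and
    (h.eventually_lineMap_mem hya hpos hx')).filter_mono nhdsWithin_le_nhds).and
    (self_mem_nhdsWithin (s := Set.Ioi (0 : ℝ)))).exists
  have heq : AffineMap.lineMap y x r = AffineMap.lineMap y x' r :=
    hf hr hr' (by rw [AffineMap.apply_lineMap, AffineMap.apply_lineMap, hxx'])
  simpa [AffineMap.lineMap_apply, hr0.ne'] using heq

theorem exists_image (h : IsSlackMap S v T) {f : E →ᵃ[ℝ] F}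
    (hf : Set.InjOn f (affineSpan ℝ (Set.range v))) :
    ∃ T' : ι → F →ᵃ[ℝ] ℝ, IsSlackMap S (f ∘ v) T' := by
  obtain ⟨g, hg⟩ := exists_affineMap_leftInverse hf
  refine ⟨fun i => (T i).comp g, fun i j => ?_, h.nonneg, fun x hx hpos => ?_⟩
  · simp [hg _ (subset_affineSpan ℝ _ ⟨j, rfl⟩), h.apply_eq]
  · rw [Set.range_comp, ← AffineSubspace.map_span] at hx
    obtain ⟨x, hx, rfl⟩ := hx
    simp only [AffineMap.coe_comp, Function.comp_apply, hg x hx] at hpos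
    rw [Set.range_comp, ← AffineMap.image_convexHull]
    exact ⟨x, h.mem x hx hpos, rfl⟩

end IsSlackMap

/-! ### Slack maps and slack matrices -/

section SlackMatrix

variable {m n d : ℕ} {S : Matrix (Fin m) (Fin n) ℝ}

theorem IsSlackMatrix.exists_isSlackMap {P : Set (Fin d → ℝ)} (h : IsSlackMatrix S P) :
    ∃ (v : Fin n → Fin d → ℝ) (T : Fin m → (Fin d → ℝ) →ᵃ[ℝ] ℝ),
      P = convexHull ℝ (Set.range v) ∧ IsSlackMap S v T := by
  obtain ⟨v, A, b, hv, hA, hS⟩ := h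
  let T : Fin m → (Fin d → ℝ) →ᵃ[ℝ] ℝ := fun i =>
    AffineMap.const ℝ (Fin d → ℝ) (b i) - (LinearMap.proj i ∘ₗ A.mulVecLin).toAffineMap
  have hT : ∀ i x, T i x = b i - A.mulVec x i := fun i x => rfl
  have hP : ∀ x, x ∈ convexHull ℝ (Set.range v) ↔ ∀ i, 0 ≤ T i x := fun x => by
    rw [← hv, hA]
    simp [hT]
  refine ⟨v, T, hv, fun i j => (hS i j).symm, fun i j => ?_, fun x _ hx => (hP x).2 hx⟩
  rw [hS, ← hT]
  exact (hP _).1 (subset_convexHull ℝ _ ⟨j, rfl⟩) i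

theorem IsSlackMap.isSlackMatrix {v : Fin n → Fin d → ℝ} {T : Fin m → (Fin d → ℝ) →ᵃ[ℝ] ℝ}
    (h : IsSlackMap S v T) (htop : affineSpan ℝ (Set.range v) = ⊤) :
    IsSlackMatrix S (convexHull ℝ (Set.range v)) := by
  let A : Matrix (Fin m) (Fin d) ℝ := LinearMap.toMatrix' (LinearMap.pi fun i => -(T i).linear)
  have hA : ∀ i x, T i x = T i 0 - A.mulVec x i := fun i x => by
    rw [LinearMap.toMatrix'_mulVec, LinearMap.pi_apply, LinearMap.neg_apply, sub_neg_eq_add,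
      add_comm, (T i).decomp']
    simp
  refine ⟨v, A, fun i => T i 0, rfl, ?_, fun i j => by rw [← hA, h.apply_eq]⟩
  ext x
  simp only [Set.mem_ofPred_eq, ← sub_nonneg (b := A.mulVec x _), ← hA]
  exact ⟨fun hx i => h.nonneg_of_mem i hx, h.mem x (htop ▸ AffineSubspace.mem_top ℝ _ x)⟩

theorem IsSlackMap.exists_isSlackMatrix {E : Type*} [AddCommGroup E] [Module ℝ E]
    {v : Fin n → E} {T : Fin m → E →ᵃ[ℝ] ℝ} [Nonempty (Fin n)] (h : IsSlackMap S v T) :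
    ∃ (d : ℕ) (P : Set (Fin d → ℝ)) (f : E →ᵃ[ℝ] (Fin d → ℝ)),
      IsSlackMatrix S P ∧ IsPolytope P ∧ Set.BijOn f (convexHull ℝ (Set.range v)) P := by
  have := finiteDimensional_vectorSpan_range ℝ v
  obtain ⟨d, f, hf, htop⟩ :=
    exists_affineMap_injOn_affineSpan_image_eq_top (𝕜 := ℝ) (Set.range_nonempty v)
  obtain ⟨T', hT'⟩ := h.exists_image hf
  rw [← Set.range_comp] at htop
  refine ⟨d, _, f, hT'.isSlackMatrix htop, ⟨_, Set.finite_range _, rfl⟩, ?_⟩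
  rw [Set.range_comp, ← AffineMap.image_convexHull]
  exact (hf.mono (convexHull_subset_affineSpan _)).bijOn_image

theorem IsSlackMatrix.exists_separator {P : Set (Fin d → ℝ)} (h : IsSlackMatrix S P) {d₁ d₂ : ℕ}
    {P₁ : Set (Fin d₁ → ℝ)} {P₂ : Set (Fin d₂ → ℝ)} (hP : IsProductOf P P₁ P₂) :
    ∃ X : Set (Fin m), IsSeparator (facetSpace S) X ∧
      (∃ i ∈ X, IsFacetRow S i) ∧ ∃ i ∉ X, IsFacetRow S i := by
  obtain ⟨-, -, h₁, h₂, f, hf⟩ := hP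
  obtain ⟨v, T, rfl, hT⟩ := h.exists_isSlackMap
  obtain ⟨T', hT'⟩ := hT.exists_image (hT.injOn_affineSpan hf.injOn)
  refine hT'.exists_facet_separator_of_prod ?_ h₁ h₂
  rw [← hf.image_eq, AffineMap.image_convexHull, Set.range_comp]

end SlackMatrix

/-! ### Polytopes with a separator are Cartesian products -/

namespace IsSlackMap

variable {ι κ E : Type*} [AddCommGroup E] [Module ℝ E] [Finite ι] [Finite κ] {S : Matrix ι κ ℝ}
  {v : κ → E} {T : ι → E →ᵃ[ℝ] ℝ} {X : Set ι}

theorem exists_mem_glue_of_isSeparator (h : IsSlackMap S v T) (hX : IsSeparator (facetSpace S) X)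
    {x₁ x₂ : E} (h₁ : x₁ ∈ affineSpan ℝ (Set.range v)) (h₂ : x₂ ∈ affineSpan ℝ (Set.range v))
    (hpos₁ : ∀ i ∈ facetRows S ∩ X, 0 ≤ T i x₁) (hpos₂ : ∀ i ∈ facetRows S ∩ Xᶜ, 0 ≤ T i x₂) :
    ∃ x ∈ convexHull ℝ (Set.range v),
      rowMap T (facetRows S ∩ X) x = rowMap T (facetRows S ∩ X) x₁ ∧
      rowMap T (facetRows S ∩ Xᶜ) x = rowMap T (facetRows S ∩ Xᶜ) x₂ := by
  obtain ⟨x, hx, hx₁, hx₂⟩ := h.exists_glue_of_isSeparator hX h₁ h₂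
  have hrow : ∀ {Y : Set ι} {y : E}, (∀ i ∈ Y, T i x = T i y) → rowMap T Y x = rowMap T Y y :=
    fun {Y y} hY => funext fun i => by
      by_cases hi : i ∈ Y
      · rw [rowMap_of_mem T hi, rowMap_of_mem T hi, hY i hi]
      · rw [rowMap_of_notMem T hi, rowMap_of_notMem T hi]
  refine ⟨x, h.mem_of_facetRows hx fun i hi => ?_, hrow hx₁, hrow hx₂⟩
  by_cases hiX : i ∈ X
  · exact hx₁ i ⟨hi, hiX⟩ ▸ hpos₁ i ⟨hi, hiX⟩
  · exact hx₂ i ⟨hi, hiX⟩ ▸ hpos₂ i ⟨hi, hiX⟩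

theorem isSlackMap_rowsIn (h : IsSlackMap S v T) (hX : IsSeparator (facetSpace S) X) :
    IsSlackMap (rowsIn S (facetRows S ∩ X)) (rowMap T (facetRows S ∩ X) ∘ v)
      fun i => (LinearMap.proj i : (ι → ℝ) →ₗ[ℝ] ℝ).toAffineMap := by
  refine ⟨fun i j => ?_, fun i j => Set.indicator_nonneg (fun i _ => h.nonneg i j) i,
    fun c hc hpos => ?_⟩
  · rw [h.rowMap_comp]
    rfl
  · obtain ⟨_, j, -⟩ := (affineSpan_nonempty ℝ).1 ⟨c, hc⟩
    rw [Set.range_comp, ← AffineSubspace.map_span] at hc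
    obtain ⟨x, hx, rfl⟩ := hc
    obtain ⟨y, hy, hyx, -⟩ := h.exists_mem_glue_of_isSeparator hX hx
      (subset_affineSpan ℝ _ ⟨j, rfl⟩) (fun i hi => by simpa [rowMap_of_mem T hi] using hpos i)
      (fun i _ => h.nonneg_apply i _ ⟨j, rfl⟩)
    rw [Set.range_comp, ← AffineMap.image_convexHull]
    exact ⟨y, hy, hyx⟩

theorem bijOn_rowMap_prod (h : IsSlackMap S v T) (hX : IsSeparator (facetSpace S) X) :
    Set.BijOn ((rowMap T (facetRows S ∩ X)).prod (rowMap T (facetRows S ∩ Xᶜ)))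
      (convexHull ℝ (Set.range v))
      ((rowMap T (facetRows S ∩ X) '' convexHull ℝ (Set.range v)) ×ˢ
        (rowMap T (facetRows S ∩ Xᶜ) '' convexHull ℝ (Set.range v))) := by
  refine ⟨fun x hx => ⟨⟨x, hx, rfl⟩, ⟨x, hx, rfl⟩⟩, fun x hx y hy hxy => ?_, ?_⟩
  · refine h.eq_of_facetRows hx (convexHull_subset_affineSpan _ hy) fun i hi => ?_
    obtain ⟨h₁, h₂⟩ := Prod.ext_iff.1 hxy
    by_cases hiX : i ∈ X
    · have hi' : i ∈ facetRows S ∩ X := ⟨hi, hiX⟩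
      simpa [rowMap_of_mem T hi'] using congrFun h₁ i
    · have hi' : i ∈ facetRows S ∩ Xᶜ := ⟨hi, hiX⟩
      simpa [rowMap_of_mem T hi'] using congrFun h₂ i
  · rintro ⟨_, _⟩ ⟨⟨x₁, hx₁, rfl⟩, ⟨x₂, hx₂, rfl⟩⟩
    obtain ⟨x, hx, h₁, h₂⟩ := h.exists_mem_glue_of_isSeparator hX
      (convexHull_subset_affineSpan _ hx₁) (convexHull_subset_affineSpan _ hx₂)
      (fun i _ => h.nonneg_of_mem i hx₁) (fun i _ => h.nonneg_of_mem i hx₂)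
    exact ⟨x, hx, Prod.ext h₁ h₂⟩

end IsSlackMap

section Sound

variable {m n d : ℕ} {S : Matrix (Fin m) (Fin n) ℝ} {X : Set (Fin m)}

theorem IsSlackMap.exists_factor {E : Type*} [AddCommGroup E] [Module ℝ E] {v : Fin n → E}
    {T : Fin m → E →ᵃ[ℝ] ℝ} (h : IsSlackMap S v T) (hX : IsSeparator (facetSpace S) X)
    (hi : ∃ i ∈ X, IsFacetRow S i) :
    ∃ (d : ℕ) (P : Set (Fin d → ℝ)) (f : (Fin m → ℝ) →ᵃ[ℝ] (Fin d → ℝ)),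
      IsSlackMatrix (rowsIn S (facetRows S ∩ X)) P ∧ IsPolytope P ∧ P.Nontrivial ∧
        Set.BijOn f (rowMap T (facetRows S ∩ X) '' convexHull ℝ (Set.range v)) P := by
  obtain ⟨i, hiX, hi⟩ := hi
  obtain ⟨j, j', hne⟩ := hi.prop
  have : Nonempty (Fin n) := ⟨j⟩
  obtain ⟨d, P, f, hS, hP, hf⟩ := (h.isSlackMap_rowsIn hX).exists_isSlackMatrix
  rw [Set.range_comp, ← AffineMap.image_convexHull] at hf
  refine ⟨d, P, f, hS, hP, hf.image_eq ▸ Set.Nontrivial.image_of_injOn ?_ hf.injOn, hf⟩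
  have hmem : i ∈ facetRows S ∩ X := ⟨hi, hiX⟩
  refine ⟨_, ⟨v j, subset_convexHull ℝ _ ⟨j, rfl⟩, rfl⟩, _,
    ⟨v j', subset_convexHull ℝ _ ⟨j', rfl⟩, rfl⟩, fun heq => hne ?_⟩
  simpa [rowMap_of_mem T hmem, h.apply_eq] using congrFun heq i

theorem IsSlackMatrix.exists_isProductOf {P : Set (Fin d → ℝ)} (h : IsSlackMatrix S P)
    (hX : IsSeparator (facetSpace S) X) (h₁ : ∃ i ∈ X, IsFacetRow S i)
    (h₂ : ∃ i ∉ X, IsFacetRow S i) :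
    ∃ (d₁ d₂ : ℕ) (P₁ : Set (Fin d₁ → ℝ)) (P₂ : Set (Fin d₂ → ℝ)), IsProductOf P P₁ P₂ ∧
      IsSlackMatrix (rowsIn S (facetRows S ∩ X)) P₁ ∧
      IsSlackMatrix (rowsIn S (facetRows S ∩ Xᶜ)) P₂ := by
  obtain ⟨v, T, rfl, hT⟩ := h.exists_isSlackMap
  obtain ⟨d₁, P₁, f₁, hS₁, hP₁, hn₁, hf₁⟩ := hT.exists_factor hX h₁
  obtain ⟨d₂, P₂, f₂, hS₂, hP₂, hn₂, hf₂⟩ := hT.exists_factor hX.compl h₂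
  exact ⟨d₁, d₂, P₁, P₂, ⟨hP₁, hP₂, hn₁, hn₂, (f₁.prodMap f₂).comp _,
    (hf₁.prodMap hf₂).comp (hT.bijOn_rowMap_prod hX)⟩, hS₁, hS₂⟩

end Sound

/-! ### Projection matrices and components -/

section Projection

variable {ι : Type*} [Fintype ι] {Q : Matrix ι ι ℝ} {C : Submodule ℝ (ι → ℝ)}

open Matrix

/-- The matrix of the orthogonal projection onto a subspace. -/
structure IsProjectionMatrix (Q : Matrix ι ι ℝ) (C : Submodule ℝ (ι → ℝ)) : Prop where
  isSymm : Q.IsSymm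
  apply_mem : ∀ c ∈ C, Q *ᵥ c = c
  mulVec_mem : ∀ x, Q *ᵥ x ∈ C

theorem isProjectionMatrix_zero_bot : IsProjectionMatrix (0 : Matrix ι ι ℝ) ⊥ :=
  ⟨isSymm_zero, fun c hc => by rw [(Submodule.mem_bot ℝ).1 hc, mulVec_zero],
    fun x => by rw [zero_mulVec]; exact Submodule.zero_mem _⟩

namespace IsProjectionMatrix

theorem dotProduct_sub_mulVec (hQ : IsProjectionMatrix Q C) (u : ι → ℝ) {c : ι → ℝ} (hc : c ∈ C) :
    (u - Q *ᵥ u) ⬝ᵥ c = 0 := by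
  have hsymm : (Q *ᵥ u) ⬝ᵥ c = u ⬝ᵥ (Q *ᵥ c) := by
    rw [dotProduct_mulVec, ← mulVec_transpose, hQ.isSymm.eq]
  rw [sub_dotProduct, hsymm, hQ.apply_mem c hc, sub_self]

-- One step of the Gram-Schmidt process. If `w = 0`, then `u ∈ C`, and `(w ⬝ᵥ w)⁻¹ = 0`.
theorem add_vecMulVec (hQ : IsProjectionMatrix Q C) {u w : ι → ℝ} (hw : w = u - Q *ᵥ u) :
    IsProjectionMatrix (Q + (w ⬝ᵥ w)⁻¹ • vecMulVec w w) (C ⊔ ℝ ∙ u) := by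
  have hperp : ∀ c ∈ C, w ⬝ᵥ c = 0 := fun c hc => hw ▸ hQ.dotProduct_sub_mulVec u hc
  have hu : u = w + Q *ᵥ u := by rw [hw, sub_add_cancel]
  have happly : ∀ x, (Q + (w ⬝ᵥ w)⁻¹ • vecMulVec w w) *ᵥ x =
      Q *ᵥ x + ((w ⬝ᵥ w)⁻¹ * w ⬝ᵥ x) • w := fun x => by
    rw [add_mulVec, smul_mulVec, vecMulVec_mulVec, op_smul_eq_smul, smul_smul]
  have hwu : w ⬝ᵥ u = w ⬝ᵥ w := by
    conv_lhs => rw [hu, dotProduct_add, hperp _ (hQ.mulVec_mem u), add_zero]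
  have hww : ((w ⬝ᵥ w)⁻¹ * w ⬝ᵥ w) • w = w := by
    rcases eq_or_ne (w ⬝ᵥ w) 0 with h0 | h0
    · rw [dotProduct_self_eq_zero.1 h0, smul_zero]
    · rw [inv_mul_cancel₀ h0, one_smul]
  have hwC : w ∈ C ⊔ ℝ ∙ u := hw ▸ Submodule.sub_mem _
    (Submodule.mem_sup_right (Submodule.mem_span_singleton_self u))
    (Submodule.mem_sup_left (hQ.mulVec_mem u))
  refine ⟨hQ.isSymm.add (IsSymm.smul (transpose_vecMulVec w w) _), fun c hc => ?_, fun x => ?_⟩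
  · obtain ⟨c, hcC, _, hru, rfl⟩ := Submodule.mem_sup.1 hc
    obtain ⟨r, rfl⟩ := Submodule.mem_span_singleton.1 hru
    have hfix : (Q + (w ⬝ᵥ w)⁻¹ • vecMulVec w w) *ᵥ u = u := by
      rw [happly, hwu, hww, add_comm, ← hu]
    rw [mulVec_add, mulVec_smul, hfix, happly, hQ.apply_mem c hcC, hperp c hcC, mul_zero,
      zero_smul, add_zero]
  · rw [happly]
    exact Submodule.add_mem _ (Submodule.mem_sup_left (hQ.mulVec_mem x))
      (Submodule.smul_mem _ _ hwC)

-- `X` is a separator if and only if `Q` commutes with the coordinate projection `D` to `X`: if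
-- `D` maps `C` to itself, then `Q * D * Q = D * Q`, and the left side is symmetric.
theorem isSeparator_iff (hQ : IsProjectionMatrix Q C) {X : Set ι} :
    IsSeparator C X ↔ ∀ i j, Q i j ≠ 0 → (i ∈ X ↔ j ∈ X) := by
  classical
  let D : Matrix ι ι ℝ := diagonal (X.indicator 1)
  have hD : ∀ c, D *ᵥ c = X.indicator c := fun c => by
    ext i
    by_cases hi : i ∈ X <;> simp [D, mulVec_diagonal, hi]
  have hcomm : D * Q = Q * D ↔ ∀ i j, Q i j ≠ 0 → (i ∈ X ↔ j ∈ X) := by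
    rw [← Matrix.ext_iff]
    refine forall₂_congr fun i j => ?_
    by_cases hi : i ∈ X <;> by_cases hj : j ∈ X <;>
      simp [D, diagonal_mul, mul_diagonal, hi, hj, eq_comm]
  rw [← hcomm]
  refine ⟨fun hX => ?_, fun h c hc => ?_⟩
  · have hQDQ : Q * (D * Q) = D * Q := ext_of_mulVec_single fun i => by
      simpa only [← mulVec_mulVec, hD] using hQ.apply_mem _ (hX _ (hQ.mulVec_mem _))
    have := congrArg transpose hQDQ
    rwa [transpose_mul, transpose_mul, hQ.isSymm.eq, diagonal_transpose, mul_assoc, hQDQ] at this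
  · rw [← hD, ← hQ.apply_mem c hc, mulVec_mulVec, h, ← mulVec_mulVec]
    exact hQ.mulVec_mem _

end IsProjectionMatrix

end Projection

section Components

variable {ι α : Type*}

/-- The labels `κ` number the connected components of the relation `R`: their classes form the
finest partition for which related elements lie in the same class. -/
def IsComponentLabelling (R : ι → ι → Prop) (κ : ι → α) : Prop :=
  ∀ r : Setoid ι, Setoid.ker κ ≤ r ↔ ∀ i j, R i j → r i j

theorem isComponentLabelling_of_injective {κ : ι → α} (hκ : κ.Injective) :
    IsComponentLabelling (fun _ _ => False) κ := fun r => by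
  simp [(Setoid.injective_iff_ker_bot κ).1 hκ]

/-- Replace the label of `a` by the label of `b` wherever it occurs. -/
def mergeLabels [DecidableEq α] (κ : ι → α) (a b : ι) (i : ι) : α :=
  if κ i = κ a then κ b else κ i

theorem ker_mergeLabels_le_iff [DecidableEq α] {κ : ι → α} {a b : ι} {r : Setoid ι} :
    Setoid.ker (mergeLabels κ a b) ≤ r ↔ Setoid.ker κ ≤ r ∧ r a b := by
  refine ⟨fun h => ⟨fun i j hij => h ?_, h ?_⟩, fun ⟨h, hab⟩ i j hij => ?_⟩
  · rw [Setoid.ker_def] at hij ⊢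
    simp only [mergeLabels, hij]
  · simp [Setoid.ker_def, mergeLabels]
  · have hκ : ∀ {i j}, κ i = κ j → r i j := fun hij => h hij
    rw [Setoid.ker_def] at hij
    simp only [mergeLabels] at hij
    split_ifs at hij with hi hj hj
    · exact hκ (hi.trans hj.symm)
    · exact r.trans (hκ hi) (r.trans hab (hκ hij))
    · exact r.trans (hκ hij) (r.trans (r.symm hab) (hκ hj.symm))
    · exact hκ hij

theorem IsComponentLabelling.mergeLabels [DecidableEq α] {R R' : ι → ι → Prop} {κ : ι → α}
    (h : IsComponentLabelling R κ) {a b : ι} (hR : ∀ i j, R' i j ↔ R i j ∨ i = a ∧ j = b) :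
    IsComponentLabelling R' (mergeLabels κ a b) := fun r => by
  rw [ker_mergeLabels_le_iff, h r]
  simp only [hR]
  exact ⟨fun ⟨h, hab⟩ i j => Or.rec (h i j) (by rintro ⟨rfl, rfl⟩; exact hab),
    fun h => ⟨fun i j hij => h i j (.inl hij), h a b (.inr ⟨rfl, rfl⟩)⟩⟩

theorem IsProjectionMatrix.isSeparator_iff_of_isComponentLabelling [Fintype ι]
    {Q : Matrix ι ι ℝ} {C : Submodule ℝ (ι → ℝ)} (hQ : IsProjectionMatrix Q C) {κ : ι → α}
    (hκ : IsComponentLabelling (fun i j => Q i j ≠ 0) κ) {X : Set ι} :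
    IsSeparator C X ↔ ∀ i j, κ i = κ j → (i ∈ X ↔ j ∈ X) := by
  have hker : ∀ i j, Setoid.ker (· ∈ X) i j ↔ (i ∈ X ↔ j ∈ X) := fun i j => by
    rw [Setoid.ker_def, eq_iff_iff]
  rw [hQ.isSeparator_iff]
  simpa only [hker, Setoid.le_def, Setoid.ker_def] using (hκ (Setoid.ker (· ∈ X))).symm

end Components

/-! ### Structured programs -/

namespace RealRAM

namespace Store

@[simp] theorem setVar_nat (s : Store) (x k : ℕ) : (s.setVar x k).nat = s.nat := rfl

@[simp] theorem setReal_var (s : Store) (a i j : ℕ) (r : ℝ) :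
    (s.setReal a i j r).var = s.var := rfl

@[simp] theorem setVar_var_self (s : Store) (x k : ℕ) : (s.setVar x k).var x = k :=
  if_pos rfl

theorem setVar_var_of_ne (s : Store) {x x' : ℕ} (h : x' ≠ x) (k : ℕ) :
    (s.setVar x k).var x' = s.var x' :=
  if_neg h

/-- The format of the input, as a valuation of the variables of a time bound. -/
def format (s : Store) : Fin 2 → ℕ := fun y => s.var y

/-- A pass of a counted loop: run the body `f`, then increment the counter `x`. -/
def countUp (x : ℕ) (f : Store → Store) (s : Store) : Store :=
  (f s).setVar x ((f s).var x + 1)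

end Store

/-- Programs whose loops are counted, so that they halt on every input: `forTo x y c` runs `c` with
the variable `x` counting up from `0` as long as it is less than the variable `y`, one of the two
variables that hold the format of the input. -/
inductive Code : Type
  | skip
  | setVar (x : ℕ) (e : NatExpr)
  | setNat (a : ℕ) (i j : NatExpr) (e : NatExpr)
  | setReal (a : ℕ) (i j : NatExpr) (e : RealExpr)
  | seq (c₁ c₂ : Code)
  | ite (b : Test) (c₁ c₂ : Code)
  | forTo (x : ℕ) (y : Fin 2) (c : Code)

/-- The parts of the memory that a program refers to by name; an array counts as one part. -/
inductive Cell : Type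
  | var (x : ℕ)
  | nat (a : ℕ)
  | real (a : ℕ)
  deriving DecidableEq

/-- The memories `s` and `s'` agree outside the cells of `W`. -/
structure SameOff (W : List Cell) (s s' : Store) : Prop where
  var : ∀ x, .var x ∉ W → s'.var x = s.var x
  nat : ∀ a, .nat a ∉ W → s'.nat a = s.nat a
  real : ∀ a, .real a ∉ W → s'.real a = s.real a

namespace SameOff

variable {W W' : List Cell} {s s' s'' : Store}

theorem refl (W : List Cell) (s : Store) : SameOff W s s :=
  ⟨fun _ _ => rfl, fun _ _ => rfl, fun _ _ => rfl⟩

theorem trans (h : SameOff W s s') (h' : SameOff W s' s'') : SameOff W s s'' :=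
  ⟨fun x hx => (h'.var x hx).trans (h.var x hx), fun a ha => (h'.nat a ha).trans (h.nat a ha),
    fun a ha => (h'.real a ha).trans (h.real a ha)⟩

theorem mono (h : SameOff W s s') (hW : W ⊆ W') : SameOff W' s s' :=
  ⟨fun x hx => h.var x fun h' => hx (hW h'), fun a ha => h.nat a fun h' => ha (hW h'),
    fun a ha => h.real a fun h' => ha (hW h')⟩

theorem setVar (h : SameOff W s s') {x : ℕ} (hx : .var x ∈ W) (k : ℕ) :
    SameOff W s (s'.setVar x k) where
  var x' hx' := by
    rw [Store.setVar_var_of_ne _ (by rintro rfl; exact hx' hx), h.var x' hx']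
  nat := h.nat
  real := h.real

theorem append_left (h : SameOff W s s') (W' : List Cell) : SameOff (W ++ W') s s' :=
  h.mono (List.subset_append_left _ _)

theorem append_right (h : SameOff W' s s') (W : List Cell) : SameOff (W ++ W') s s' :=
  h.mono (List.subset_append_right _ _)

end SameOff

namespace Code

/-- The program that a structured program stands for. -/
def toProgram : Code → Program
  | skip => .skip
  | setVar x e => .setVar x e
  | setNat a i j e => .setNat a i j e
  | setReal a i j e => .setReal a i j e
  | seq c₁ c₂ => .seq c₁.toProgram c₂.toProgram
  | ite b c₁ c₂ => .ite b c₁.toProgram c₂.toProgram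
  | forTo x y c => .seq (.setVar x (.const 0))
      (.loop (.natLt (.var x) (.var y)) (.seq c.toProgram (.setVar x (.add (.var x) (.const 1)))))

open Classical in
/-- The memory after the execution of a structured program, as a function of the memory before. -/
noncomputable def exec : Code → Store → Store
  | skip, s => s
  | setVar x e, s => s.setVar x (e.eval s)
  | setNat a i j e, s => s.setNat a (i.eval s) (j.eval s) (e.eval s)
  | setReal a i j e, s => s.setReal a (i.eval s) (j.eval s) (e.eval s)
  | seq c₁ c₂, s => c₂.exec (c₁.exec s)
  | ite b c₁ c₂, s => if b.Holds s then c₁.exec s else c₂.exec s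
  | forTo x y c, s => (Store.countUp x c.exec)^[s.var y] (s.setVar x 0)

/-- A bound for the number of steps, a polynomial in the format of the input. -/
noncomputable def bound : Code → MvPolynomial (Fin 2) ℕ
  | skip => 1
  | setVar _ e => (e.cost + 1 : ℕ)
  | setNat _ i j e => (i.cost + j.cost + e.cost + 1 : ℕ)
  | setReal _ i j e => (i.cost + j.cost + e.cost + 1 : ℕ)
  | seq c₁ c₂ => c₁.bound + c₂.bound
  | ite b c₁ c₂ => (b.cost + 1 : ℕ) + c₁.bound + c₂.bound
  | forTo _ y c => 6 + MvPolynomial.X y * (c.bound + 8)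

/-- The cells that a structured program assigns to. -/
def writes : Code → List Cell
  | skip => []
  | setVar x _ => [.var x]
  | setNat a _ _ _ => [.nat a]
  | setReal a _ _ _ => [.real a]
  | seq c₁ c₂ => c₁.writes ++ c₂.writes
  | ite _ c₁ c₂ => c₁.writes ++ c₂.writes
  | forTo x _ c => .var x :: c.writes

/-- Well-formedness: the program does not assign to the format of the input, and the bodies of loops
do not assign to their counters. -/
def wf : Code → Bool
  | setVar x _ => 2 ≤ x
  | seq c₁ c₂ => c₁.wf && c₂.wf
  | ite _ c₁ c₂ => c₁.wf && c₂.wf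
  | forTo x _ c => 2 ≤ x && .var x ∉ c.writes && c.wf
  | _ => true

theorem wf_forTo {x : ℕ} {y : Fin 2} {c : Code} :
    (forTo x y c).wf ↔ 2 ≤ x ∧ .var x ∉ c.writes ∧ c.wf := by
  simp [wf, and_assoc]

theorem sameOff_iterate_countUp {f : Store → Store} {W : List Cell}
    (hf : ∀ s, SameOff W s (f s)) (x r : ℕ) (s : Store) :
    SameOff (.var x :: W) s ((Store.countUp x f)^[r] s) := by
  induction r with
  | zero => exact .refl _ s
  | succ r ih =>
    rw [Function.iterate_succ_apply']
    exact ih.trans (((hf _).mono (List.subset_cons_self _ _)).setVar List.mem_cons_self _)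

theorem sameOff_exec (c : Code) (s : Store) : SameOff c.writes s (c.exec s) := by
  induction c generalizing s with
  | skip => exact .refl _ s
  | setVar x e => exact (SameOff.refl _ s).setVar (List.mem_singleton_self _) _
  | setNat a i j e =>
    refine ⟨fun _ _ => rfl, fun a' ha => ?_, fun _ _ => rfl⟩
    have : a' ≠ a := by simpa [writes] using ha
    simp [exec, Store.setNat, this]
  | setReal a i j e =>
    refine ⟨fun _ _ => rfl, fun _ _ => rfl, fun a' ha => ?_⟩
    have : a' ≠ a := by simpa [writes] using ha
    simp [exec, Store.setReal, this]
  | seq c₁ c₂ ih₁ ih₂ => exact ((ih₁ s).append_left _).trans ((ih₂ _).append_right _)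
  | ite b c₁ c₂ ih₁ ih₂ =>
    rw [exec]
    split_ifs
    exacts [(ih₁ s).append_left _, (ih₂ s).append_right _]
  | forTo x y c ih =>
    exact ((SameOff.refl _ s).setVar List.mem_cons_self 0).trans
      (sameOff_iterate_countUp ih x _ _)

theorem two_le_of_var_mem_writes {c : Code} (h : c.wf) {x : ℕ} (hx : .var x ∈ c.writes) :
    2 ≤ x := by
  induction c with
  | setVar x' e => simp_all [wf, writes]
  | seq c₁ c₂ ih₁ ih₂ =>
    simp only [wf, Bool.and_eq_true, writes, List.mem_append] at h hx
    exact hx.elim (ih₁ h.1) (ih₂ h.2)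
  | ite b c₁ c₂ ih₁ ih₂ =>
    simp only [wf, Bool.and_eq_true, writes, List.mem_append] at h hx
    exact hx.elim (ih₁ h.1) (ih₂ h.2)
  | forTo x' y c ih =>
    obtain ⟨hx', -, hc⟩ := wf_forTo.1 h
    rcases List.mem_cons.1 hx with hxx' | hx
    exacts [Cell.var.inj hxx' ▸ hx', ih hc hx]
  | _ => simp [writes] at hx

theorem var_format_eq_of_sameOff {c : Code} (h : c.wf) {s s' : Store} (hs : SameOff c.writes s s')
    (y : Fin 2) : s'.var y = s.var y :=
  hs.var _ fun hy => absurd (two_le_of_var_mem_writes h hy) (by omega)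

theorem exec_format {c : Code} (h : c.wf) (s : Store) : (c.exec s).format = s.format :=
  funext fun y => var_format_eq_of_sameOff h (sameOff_exec c s) y

theorem format_countUp_exec {x : ℕ} {y : Fin 2} {c : Code} (h : (forTo x y c).wf) (s : Store) :
    (Store.countUp x c.exec s).format = s.format := by
  obtain ⟨hx, -, hc⟩ := wf_forTo.1 h
  rw [← exec_format hc s]
  exact funext fun y => Store.setVar_var_of_ne _ (by omega) _

theorem countUp_exec_var_self {x : ℕ} {y : Fin 2} {c : Code} (h : (forTo x y c).wf) (s : Store) :
    (Store.countUp x c.exec s).var x = s.var x + 1 := by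
  rw [Store.countUp, Store.setVar_var_self, (sameOff_exec c s).var x (wf_forTo.1 h).2.1]

theorem runs_loop_of_runs {x : ℕ} {y : Fin 2} {c : Code} (h : (forTo x y c).wf) {B : ℕ}
    (r : ℕ) {s : Store}
    (hc : ∀ s', s'.format = s.format → ∃ t ≤ B, Runs c.toProgram s' (c.exec s') t)
    (hr : s.var x + r = s.var y) :
    ∃ t ≤ r * (B + 8) + 4, Runs (.loop (.natLt (.var x) (.var y))
      (.seq c.toProgram (.setVar x (.add (.var x) (.const 1))))) s
      ((Store.countUp x c.exec)^[r] s) t := by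
  induction r generalizing s with
  | zero =>
    exact ⟨_, by simp [Test.cost, NatExpr.cost],
      .loopDone (by simp only [Test.Holds, NatExpr.eval]; omega)⟩
  | succ r ih =>
    have hf := format_countUp_exec h s
    have hy : (Store.countUp x c.exec s).var y = s.var y := congrFun hf y
    obtain ⟨t, htB, ht⟩ := hc s rfl
    obtain ⟨t', htB', ht'⟩ := ih (s := Store.countUp x c.exec s)
      (fun s' hs' => hc s' (hs'.trans hf))
      (by rw [countUp_exec_var_self h, hy]; omega)
    refine ⟨_, ?_, .loopStep (by simp only [Test.Holds, NatExpr.eval]; omega)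
      (.seq ht (.setVar _ x _)) ht'⟩
    simp only [Test.cost, NatExpr.cost]
    rw [add_one_mul]
    omega

theorem exists_runs_exec {c : Code} (h : c.wf) (s : Store) :
    ∃ t ≤ MvPolynomial.eval s.format c.bound, Runs c.toProgram s (c.exec s) t := by
  induction c generalizing s with
  | skip => exact ⟨1, by simp [bound], .skip s⟩
  | setVar x e => exact ⟨_, by simp [bound], .setVar s x e⟩
  | setNat a i j e => exact ⟨_, by simp [bound], .setNat s a i j e⟩
  | setReal a i j e => exact ⟨_, by simp [bound], .setReal s a i j e⟩
  | seq c₁ c₂ ih₁ ih₂ =>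
    simp only [wf, Bool.and_eq_true] at h
    obtain ⟨t₁, hb₁, h₁⟩ := ih₁ h.1 s
    obtain ⟨t₂, hb₂, h₂⟩ := ih₂ h.2 (c₁.exec s)
    rw [exec_format h.1] at hb₂
    exact ⟨_, by rw [bound, map_add]; omega, .seq h₁ h₂⟩
  | ite b c₁ c₂ ih₁ ih₂ =>
    simp only [wf, Bool.and_eq_true] at h
    obtain ⟨t₁, hb₁, h₁⟩ := ih₁ h.1 s
    obtain ⟨t₂, hb₂, h₂⟩ := ih₂ h.2 s
    simp only [exec, bound, map_add, map_natCast, Nat.cast_id]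
    split_ifs with hb
    exacts [⟨_, by omega, .iteTrue hb h₁⟩, ⟨_, by omega, .iteFalse hb h₂⟩]
  | forTo x y c ih =>
    obtain ⟨hx, -, hc⟩ := wf_forTo.1 h
    have hf : (s.setVar x 0).format = s.format :=
      funext fun y => Store.setVar_var_of_ne _ (by omega) _
    obtain ⟨t, htB, ht⟩ := runs_loop_of_runs h (s.var y) (s := s.setVar x 0)
      (fun s' hs' => hf ▸ hs' ▸ ih hc s')
      (by rw [Store.setVar_var_self, zero_add]; exact (congrFun hf y).symm)
    refine ⟨_, ?_, .seq (.setVar s x (.const 0)) ht⟩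
    simp only [bound, map_add, map_mul, MvPolynomial.eval_X, map_ofNat, NatExpr.cost, Store.format]
      at htB ⊢
    omega

end Code

end RealRAM

/-! ### Loop rules -/

namespace RealRAM

namespace Store

/-- The vector of length `m` that is stored in the first column of the natural array `a`. -/
def natVec (s : Store) (a m : ℕ) : Fin m → ℕ := fun i => s.nat a i 0

/-- The vector of length `m` that is stored in the first column of the real array `a`. -/
def realVec (s : Store) (a m : ℕ) : Fin m → ℝ := fun i => s.real a i 0

end Store

namespace Code

variable {x x' a N N' : ℕ} {y y' : Fin 2} {c : Code} {s : Store}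

theorem exec_forTo (hwf : (forTo x y c).wf) (hN : s.var y = N)
    (I : Finset (Fin N) → Store → Prop) (h0 : I ∅ s)
    (hvar : ∀ A s' k, I A s' → I A (s'.setVar x k))
    (hstep : ∀ A, ∀ k : Fin N, k ∉ A → ∀ s' : Store, s'.var x = k →
      SameOff (forTo x y c).writes s s' → I A s' → I (insert k A) (c.exec s')) :
    I Finset.univ ((forTo x y c).exec s) := by
  have hs : SameOff (forTo x y c).writes s (s.setVar x 0) :=
    (SameOff.refl _ s).setVar List.mem_cons_self 0
  suffices h : ∀ K ≤ N, ((Store.countUp x c.exec)^[K] (s.setVar x 0)).var x = K ∧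
      I {k | k < K} ((Store.countUp x c.exec)^[K] (s.setVar x 0)) by
    convert (h N le_rfl).2
    · simp
    · rw [exec, hN]
  intro K hK
  induction K with
  | zero => exact ⟨Store.setVar_var_self _ _ _, by simpa using hvar _ _ 0 h0⟩
  | succ K ih =>
    obtain ⟨hx, hI⟩ := ih (by omega)
    rw [Function.iterate_succ_apply']
    have hset : ({k | (k : ℕ) < K + 1} : Finset (Fin N)) =
        insert ⟨K, hK⟩ ({k | (k : ℕ) < K} : Finset (Fin N)) := by
      ext k
      simp only [Finset.mem_filter_univ, Finset.mem_insert, Fin.ext_iff]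
      omega
    exact ⟨by rw [countUp_exec_var_self hwf, hx], hset ▸ hvar _ _ _ (hstep _ ⟨K, hK⟩ (by simp) _ hx
      (hs.trans (sameOff_iterate_countUp (sameOff_exec c) x K _)) hI)⟩

theorem exec_forTo_forTo (hwf : (forTo x y (forTo x' y' c)).wf) (hN : s.var y = N)
    (hN' : s.var y' = N') (I : Finset (Fin N × Fin N') → Store → Prop) (h0 : I ∅ s)
    (hvar : ∀ A s' z k, I A s' → I A (s'.setVar z k))
    (hstep : ∀ A, ∀ p ∉ A, ∀ s' : Store, s'.var x = p.1 → s'.var x' = p.2 →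
      SameOff (forTo x y (forTo x' y' c)).writes s s' → I A s' → I (insert p A) (c.exec s')) :
    I Finset.univ ((forTo x y (forTo x' y' c)).exec s) := by
  obtain ⟨-, hx, hwf'⟩ := wf_forTo.1 hwf
  rw [← Finset.univ_product_univ]
  refine exec_forTo hwf hN (fun A => I (A ×ˢ Finset.univ)) (by simpa using h0)
    (fun _ s' => hvar _ s' x) fun A k hk s₁ hk₁ hs₁ hI => ?_
  have hinner := exec_forTo hwf' ((var_format_eq_of_sameOff hwf hs₁ y').trans hN')
    (fun B => I (A ×ˢ Finset.univ ∪ {k} ×ˢ B)) (by simpa using hI)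
    (fun _ s' => hvar _ s' x') fun B l hl s₂ hl₂ hs₂ hI₂ => ?_
  · convert hinner using 1
    rw [Finset.insert_eq, Finset.union_product, Finset.union_comm]
  · convert hstep _ (k, l) (by simp [hk, hl]) s₂ ((hs₂.var x hx).trans hk₁) hl₂
      (hs₁.trans (hs₂.mono (List.subset_cons_self _ _))) hI₂ using 1
    rw [Finset.insert_eq, Finset.product_union, Finset.singleton_product_singleton,
      Finset.insert_eq, Finset.union_left_comm]

/-- Let the variable `z` tell whether the test `b`, made after `c`, succeeds for some value of the
counter `x`. -/
def existsFor (x : ℕ) (y : Fin 2) (c : Code) (b : Test) (z : ℕ) : Code :=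
  .seq (.setVar z (.const 0)) (.forTo x y (.seq c (.ite b (.setVar z (.const 1)) .skip)))

theorem exec_existsFor_var {b : Test} {z : ℕ} {P : Fin N → Prop} [Decidable (∃ k, P k)]
    (hwf : (existsFor x y c b z).wf) (hz : .var z ∉ Cell.var x :: c.writes) (hN : s.var y = N)
    (hP : ∀ (k : Fin N) (s' : Store), s'.var x = k → SameOff (existsFor x y c b z).writes s s' →
      (b.Holds (c.exec s') ↔ P k)) :
    ((existsFor x y c b z).exec s).var z = if ∃ k, P k then 1 else 0 := by
  classical
  simp only [existsFor, wf.eq_2, Bool.and_eq_true] at hwf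
  obtain ⟨hz2, hfor⟩ := hwf
  obtain ⟨hzx, hzc⟩ : z ≠ x ∧ .var z ∉ c.writes := by simpa using hz
  have hs := sameOff_exec (setVar z (.const 0)) s
  suffices h : ((existsFor x y c b z).exec s).var z = if ∃ k ∈ Finset.univ, P k then 1 else 0 by
    simpa using h
  refine exec_forTo hfor ((var_format_eq_of_sameOff hz2 hs y).trans hN)
    (fun A s' => s'.var z = if ∃ k ∈ A, P k then 1 else 0) (by simp [exec, NatExpr.eval])
    (fun _ _ _ h => by rwa [Store.setVar_var_of_ne _ hzx]) fun A k _ s₁ hk hs₁ hI => ?_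
  have hPk := hP k s₁ hk ((hs.append_left _).trans (hs₁.append_right _))
  simp only [Finset.exists_mem_insert]
  by_cases hk' : P k
  · simp [exec, hPk, hk', NatExpr.eval]
  · simpa [exec, hPk, hk', (sameOff_exec c s₁).var z hzc] using hI

/-- Write the values of `e`, computed after `c`, to the first column of a natural array. -/
def mapNat (x : ℕ) (y : Fin 2) (c : Code) (a : ℕ) (e : NatExpr) : Code :=
  .forTo x y (.seq c (.setNat a (.var x) (.const 0) e))

theorem natVec_exec_mapNat {e : NatExpr} {V : Fin N → ℕ} (hwf : (mapNat x y c a e).wf)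
    (ha : .nat a ∉ c.writes) (hN : s.var y = N)
    (hV : ∀ (k : Fin N) (s' : Store), s'.var x = k → SameOff (mapNat x y c a e).writes s s' →
      s'.nat a k 0 = s.nat a k 0 → e.eval (c.exec s') = V k) :
    ((mapNat x y c a e).exec s).natVec a N = V := by
  have hx : .var x ∉ c.writes := by simpa [writes] using (wf_forTo.1 hwf).2.1
  have h := exec_forTo hwf hN
    (fun A s' => ∀ k : Fin N, s'.nat a k 0 = if k ∈ A then V k else s.nat a k 0) (by simp)
    (fun _ _ _ h => h) fun A k hk s₁ hk₁ hs₁ hI l => ?_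
  · ext k
    exact (h k).trans (if_pos (Finset.mem_univ k))
  · have hVk := hV k s₁ hk₁ hs₁ (by rw [hI k, if_neg hk])
    rcases eq_or_ne l k with rfl | hlk
    · simp [exec, Store.setNat, NatExpr.eval, hVk, (sameOff_exec c s₁).var x hx, hk₁]
    · simp [exec, Store.setNat, NatExpr.eval, (sameOff_exec c s₁).var x hx, hk₁, hlk, Fin.val_inj,
        (sameOff_exec c s₁).nat a ha, hI l]

/-- Write the values of `e`, computed after `c`, to the first column of a real array. -/
def mapReal (x : ℕ) (y : Fin 2) (c : Code) (a : ℕ) (e : RealExpr) : Code :=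
  .forTo x y (.seq c (.setReal a (.var x) (.const 0) e))

theorem realVec_exec_mapReal {e : RealExpr} {V : Fin N → ℝ} (hwf : (mapReal x y c a e).wf)
    (ha : .real a ∉ c.writes) (hN : s.var y = N)
    (hV : ∀ (k : Fin N) (s' : Store), s'.var x = k → SameOff (mapReal x y c a e).writes s s' →
      e.eval (c.exec s') = V k) :
    ((mapReal x y c a e).exec s).realVec a N = V := by
  have hx : .var x ∉ c.writes := by simpa [writes] using (wf_forTo.1 hwf).2.1
  have h := exec_forTo hwf hN (fun A s' => ∀ k ∈ A, s'.real a k 0 = V k) (by simp)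
    (fun _ _ _ h => h) fun A k hk s₁ hk₁ hs₁ hI l hl => ?_
  · exact funext fun k => h k (Finset.mem_univ k)
  · have hVk := hV k s₁ hk₁ hs₁
    rcases Finset.mem_insert.1 hl with rfl | hl
    · simp [exec, Store.setReal, NatExpr.eval, hVk, (sameOff_exec c s₁).var x hx, hk₁]
    · simp [exec, Store.setReal, NatExpr.eval, (sameOff_exec c s₁).var x hx, hk₁, Fin.val_inj,
        ne_of_mem_of_not_mem hl hk, (sameOff_exec c s₁).real a ha, hI l hl]

/-- Write the values of `e`, computed after `c`, to the entries of a real array. -/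
def mapReal₂ (x : ℕ) (y : Fin 2) (x' : ℕ) (y' : Fin 2) (c : Code) (a : ℕ) (e : RealExpr) : Code :=
  .forTo x y (.forTo x' y' (.seq c (.setReal a (.var x) (.var x') e)))

theorem matrix_exec_mapReal₂ {e : RealExpr} {V : Matrix (Fin N) (Fin N') ℝ}
    (hwf : (mapReal₂ x y x' y' c a e).wf) (ha : .real a ∉ c.writes) (hN : s.var y = N)
    (hN' : s.var y' = N')
    (hV : ∀ (k : Fin N) (l : Fin N') (s' : Store), s'.var x = k → s'.var x' = l →
      SameOff (mapReal₂ x y x' y' c a e).writes s s' → s'.real a k l = s.real a k l →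
      e.eval (c.exec s') = V k l) :
    ((mapReal₂ x y x' y' c a e).exec s).matrix a N N' = V := by
  obtain ⟨-, hx, hwf'⟩ := wf_forTo.1 hwf
  replace hx : .var x ∉ c.writes := by simp_all [writes]
  have hx' : .var x' ∉ c.writes := by simpa [writes] using (wf_forTo.1 hwf').2.1
  have h := exec_forTo_forTo hwf hN hN' (fun A s' => ∀ p : Fin N × Fin N',
      s'.real a p.1 p.2 = if p ∈ A then V p.1 p.2 else s.real a p.1 p.2) (by simp)
    (fun _ _ _ _ h => h) fun A p hp s₁ hp₁ hp₂ hs₁ hI q => ?_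
  · ext k l
    exact (h (k, l)).trans (if_pos (Finset.mem_univ _))
  · have hVp := hV p.1 p.2 s₁ hp₁ hp₂ hs₁ (by rw [hI p, if_neg hp])
    rcases eq_or_ne q p with rfl | hqp
    · simp [exec, Store.setReal, NatExpr.eval, hVp, (sameOff_exec c s₁).var x hx,
        (sameOff_exec c s₁).var x' hx', hp₁, hp₂]
    · have hqp' : ¬ (q.1 = p.1 ∧ q.2 = p.2) := mt Prod.ext_iff.2 hqp
      simp [exec, Store.setReal, NatExpr.eval, (sameOff_exec c s₁).var x hx,
        (sameOff_exec c s₁).var x' hx', hp₁, hp₂, Fin.val_inj, hqp, hqp',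
        (sameOff_exec c s₁).real a ha, hI q]

/-- Sum the values of `e`, with the result at position `(0, 0)` of the real array `a`. -/
def sumFor (x : ℕ) (y : Fin 2) (a : ℕ) (e : RealExpr) : Code :=
  .seq (.setReal a (.const 0) (.const 0) (.const 0))
    (.forTo x y (.setReal a (.const 0) (.const 0) (.add (.get a (.const 0) (.const 0)) e)))

theorem exec_sumFor_real {e : RealExpr} {V : Fin N → ℝ} (hx : 2 ≤ x) (hN : s.var y = N)
    (hV : ∀ (k : Fin N) (s' : Store), s'.var x = k → SameOff (sumFor x y a e).writes s s' →
      e.eval s' = V k) :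
    ((sumFor x y a e).exec s).real a 0 0 = ∑ k, V k := by
  have hs := sameOff_exec (setReal a (.const 0) (.const 0) (.const 0)) s
  refine exec_forTo (wf_forTo.2 ⟨hx, by simp [writes], rfl⟩) (by simpa [exec] using hN)
    (fun A s' => s'.real a 0 0 = ∑ k ∈ A, V k)
    (by simp [exec, Store.setReal, NatExpr.eval, RealExpr.eval]) (fun _ _ _ h => h)
    fun A k hk s₁ hk₁ hs₁ hI => ?_
  have hVk := hV k s₁ hk₁ ((hs.append_left _).trans (hs₁.append_right _))
  simp [exec, Store.setReal, NatExpr.eval, RealExpr.eval, hI, hVk, Finset.sum_insert hk, add_comm]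

end Code

end RealRAM

/-! ### The algorithm -/

namespace RealRAM

namespace Store

/-- The format and the entries of the input matrix `S` are in memory at their places. -/
structure HasInput {m n : ℕ} (S : Matrix (Fin m) (Fin n) ℝ) (s : Store) : Prop where
  rows : s.var 0 = m
  cols : s.var 1 = n
  entries : s.matrix 0 m n = S

/-- The facet rows are marked, and the labels are constant exactly on the separators of the facet
space, in addition to the input. -/
structure HasComponents {m n : ℕ} (S : Matrix (Fin m) (Fin n) ℝ) (s : Store) : Prop
    extends HasInput S s where
  mark_iff : ∀ i : Fin m, s.nat 1 i 0 = 1 ↔ IsFacetRow S i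
  isSeparator_iff : ∀ X : Set (Fin m), IsSeparator (facetSpace S) X ↔
    ∀ i j, s.natVec 2 m i = s.natVec 2 m j → (i ∈ X ↔ j ∈ X)

/-- The rows that carry the label of the first factor. -/
def factorRows (m : ℕ) (s : Store) : Set (Fin m) := {i | s.natVec 2 m i = s.var 27}

end Store

open Store Matrix

section Frame

variable {m n : ℕ} {S : Matrix (Fin m) (Fin n) ℝ} {W : List Cell} {s s' : Store}

theorem Store.hasInput_input (S : Matrix (Fin m) (Fin n) ℝ) : HasInput S (input S) :=
  ⟨rfl, rfl, by ext; simp [Store.matrix, input]⟩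

theorem Store.HasInput.of_sameOff (h : HasInput S s) (hs : SameOff W s s')
    (hW : .var 0 ∉ W ∧ .var 1 ∉ W ∧ .real 0 ∉ W) : HasInput S s' where
  rows := (hs.var 0 hW.1).trans h.rows
  cols := (hs.var 1 hW.2.1).trans h.cols
  entries := by rw [← h.entries]; ext; simp [Store.matrix, hs.real 0 hW.2.2]

theorem Store.HasInput.real_eq (h : HasInput S s) (i : Fin m) (j : Fin n) :
    s.real 0 i j = S i j :=
  congrFun₂ h.entries i j

theorem SameOff.natVec_eq (hs : SameOff W s s') {a : ℕ} (ha : .nat a ∉ W) (m : ℕ) :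
    s'.natVec a m = s.natVec a m := by
  ext; simp [natVec, hs.nat a ha]

theorem SameOff.matrix_eq (hs : SameOff W s s') {a : ℕ} (ha : .real a ∉ W) (m n : ℕ) :
    s'.matrix a m n = s.matrix a m n := by
  ext; simp [Store.matrix, hs.real a ha]

theorem Store.HasComponents.of_sameOff {W : List Cell} {s' : Store} (h : HasComponents S s)
    (hs : SameOff W s s') (hW : .var 0 ∉ W ∧ .var 1 ∉ W ∧ .real 0 ∉ W)
    (hW' : .nat 1 ∉ W ∧ .nat 2 ∉ W) : HasComponents S s' where
  toHasInput := h.toHasInput.of_sameOff hs hW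
  mark_iff := by rw [hs.nat 1 hW'.1]; exact h.mark_iff
  isSeparator_iff := by rw [hs.natVec_eq hW'.2]; exact h.isSeparator_iff

theorem SameOff.factorRows_eq (hs : SameOff W s s') (hW : .nat 2 ∉ W ∧ .var 27 ∉ W) (m : ℕ) :
    s'.factorRows m = s.factorRows m := by
  rw [factorRows, factorRows, hs.natVec_eq hW.1, hs.var 27 hW.2]

theorem Store.HasComponents.isSeparator_factorRows (h : HasComponents S s) :
    IsSeparator (facetSpace S) (s.factorRows m) :=
  (h.isSeparator_iff _).2 fun i j hij => by rw [factorRows, Set.mem_ofPred, Set.mem_ofPred, hij]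

theorem Store.HasComponents.exists_notMem_factorRows (h : HasComponents S s) {X : Set (Fin m)}
    (hX : IsSeparator (facetSpace S) X) (h₁ : ∃ i ∈ X, IsFacetRow S i)
    (h₂ : ∃ i ∉ X, IsFacetRow S i) : ∃ i ∉ s.factorRows m, IsFacetRow S i := by
  obtain ⟨i, hiX, hi⟩ := h₁
  obtain ⟨j, hjX, hj⟩ := h₂
  by_contra! hall
  have hκ : ∀ k, IsFacetRow S k → s.natVec 2 m k = s.var 27 := fun k hk =>
    by_contra fun hne => hall k hne hk
  exact hjX (((h.isSeparator_iff X).1 hX i j ((hκ i hi).trans (hκ j hj).symm)).1 hiX)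

end Frame

namespace Code

/-- The real number in row `i` and column `j` of an array, the indices given by variables. -/
def entry (a i j : ℕ) : RealExpr := .get a (.var i) (.var j)

/-- The real number in row `i` of the first column of an array, the index given by a variable. -/
def realItem (a i : ℕ) : RealExpr := .get a (.var i) (.const 0)

/-- The natural number in row `i` of the first column of an array, the index given by a variable. -/
def natItem (a i : ℕ) : NatExpr := .get a (.var i) (.const 0)

/-- The test whether an entry of an array is `0`. -/
def isZero (a i j : ℕ) : Test := .realEq (entry a i j) (.const 0)

/- The memory of the algorithm: natural array `0` marks the nonconstant rows, `1` the facet rows,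
and `2` holds the labels of the components; real array `3` holds the facet rows, `4` the projection
matrix, and `5` the residual of the current column in the Gram-Schmidt process. Variable `27` is the
label of the first factor and variable `28` the answer. All other names are temporary. -/

/-- Decide whether some entry of the current row differs from the current entry. -/
def differCode : Code :=
  existsFor 12 1 .skip (.not (.realEq (entry 0 10 11) (entry 0 10 12))) 20

/-- Mark the nonconstant rows. -/
def nonconstCode : Code :=
  mapNat 10 0 (existsFor 11 1 differCode (.natEq (.var 20) (.const 1)) 21) 0 (.var 21)

/-- Decide whether the zero set of row `x` is not contained in that of row `x'`. -/
def compareCode (x x' z : ℕ) : Code :=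
  existsFor 12 1 .skip (.and (isZero 0 x 12) (.not (isZero 0 x' 12))) z

/-- Decide whether some nonconstant row has a larger zero set than the current one. -/
def largerCode : Code :=
  existsFor 11 0 (.seq (compareCode 10 11 21) (compareCode 11 10 22))
    (.and (.natEq (natItem 0 11) (.const 1))
      (.and (.natEq (.var 21) (.const 0)) (.natEq (.var 22) (.const 1)))) 23

/-- Mark the facet rows. -/
def facetCode : Code := mapNat 10 0 largerCode 1 (.sub (natItem 0 10) (.var 23))

/-- Copy the rows of the input that satisfy the test `b` to array `a`; the other rows become `0`. -/
def copyCode (b : Test) (a : ℕ) : Code :=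
  mapReal₂ 10 0 11 1
    (.ite b (.setReal 7 (.const 0) (.const 0) (entry 0 10 11))
      (.setReal 7 (.const 0) (.const 0) (.const 0)))
    a (.get 7 (.const 0) (.const 0))

/-- The test for the facet rows. -/
def facetTest : Test := .natEq (natItem 1 10) (.const 1)

/-- Initialize the projection matrix. -/
def zeroCode : Code := mapReal₂ 10 0 11 0 .skip 4 (.const 0)

/-- An entry of the difference of the current column and the first column of the facet rows. -/
def diffEntry (i : ℕ) : RealExpr := .sub (entry 3 i 13) (realItem 3 i)

/-- Compute the component of the current difference that is orthogonal to the previous ones. -/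
def residualCode : Code :=
  mapReal 10 0 (sumFor 12 0 6 (.mul (entry 4 10 12) (diffEntry 12))) 5
    (.sub (diffEntry 10) (.get 6 (.const 0) (.const 0)))

/-- Add the projection to the line of the residual to the projection matrix. -/
def updateCode : Code :=
  .seq (sumFor 10 0 6 (.mul (realItem 5 10) (realItem 5 10)))
    (mapReal₂ 10 0 11 0 .skip 4 (.add (entry 4 10 11)
      (.div (.mul (realItem 5 10) (realItem 5 11)) (.get 6 (.const 0) (.const 0)))))

/-- Compute the projection matrix. -/
def projCode : Code := .seq zeroCode (.forTo 13 1 (.seq residualCode updateCode))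

/-- Give each row a label of its own. -/
def initCode : Code := mapNat 10 0 .skip 2 (.var 10)

/-- Merge the labels of two rows. -/
def joinCode : Code :=
  .seq (.setVar 24 (natItem 2 10)) (.seq (.setVar 25 (natItem 2 11))
    (mapNat 12 0 (.ite (.natEq (natItem 2 12) (.var 24)) (.setVar 26 (.var 25))
      (.setVar 26 (natItem 2 12))) 2 (.var 26)))

/-- Label the components of the support of the projection matrix. -/
def compCode : Code :=
  .seq initCode (.forTo 10 0 (.forTo 11 0 (.ite (.not (isZero 4 10 11)) joinCode .skip)))

/-- Find the facet rows, the projection matrix and the components of its support. -/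
def separateCode : Code :=
  .seq nonconstCode (.seq facetCode (.seq (copyCode facetTest 3) (.seq projCode compCode)))

/-- Pick the label of a facet row, of the last one if there are several. -/
def pickCode : Code := .forTo 10 0 (.ite facetTest (.setVar 27 (natItem 2 10)) .skip)

/-- The test for the facet rows with the label that was picked. -/
def insideTest : Test := .and facetTest (.natEq (natItem 2 10) (.var 27))

/-- The test for the facet rows with the other labels. -/
def outsideTest : Test := .and facetTest (.not (.natEq (natItem 2 10) (.var 27)))

/-- Decide whether some facet row has another label. -/
def answerCode : Code := existsFor 10 0 .skip outsideTest 28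

/-- Compute the answer and the output matrices. -/
def outputCode : Code :=
  .seq pickCode (.seq answerCode (.seq (copyCode insideTest 1) (copyCode outsideTest 2)))

/-- The algorithm, without the final moves: the answer is left in variable `28` and the output
matrices in real arrays `1` and `2`. -/
def mainCode : Code := .seq separateCode outputCode

variable {m n : ℕ} {S : Matrix (Fin m) (Fin n) ℝ} {s : Store}

open Classical in
theorem exec_differCode_var {i : Fin m} {j : Fin n} (h : HasInput S s) (hi : s.var 10 = i)
    (hj : s.var 11 = j) :
    (differCode.exec s).var 20 = if ∃ j', S i j ≠ S i j' then 1 else 0 := by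
  rw [differCode]
  refine exec_existsFor_var (by decide) (by decide) h.cols fun j' s₁ hj' h₁ => ?_
  simp [Test.Holds, exec, entry, RealExpr.eval, NatExpr.eval, h₁.var 10 (by decide),
    h₁.var 11 (by decide), hi, hj, hj', (h.of_sameOff h₁ (by decide)).real_eq]

open Classical in
theorem natVec_exec_nonconstCode (h : HasInput S s) :
    (nonconstCode.exec s).natVec 0 m = fun i => if NonconstRow S i then 1 else 0 := by
  refine natVec_exec_mapNat (by decide) (by decide) h.rows fun i s₁ hi h₁ _ => ?_
  refine (exec_existsFor_var (x := 11) (z := 21) (P := fun j => ∃ j', S i j ≠ S i j') (by decide)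
    (by decide) (h.of_sameOff h₁ (by decide)).cols fun j s₂ hj h₂ => ?_).trans
    (if_congr Iff.rfl rfl rfl)
  have hvar := exec_differCode_var ((h.of_sameOff h₁ (by decide)).of_sameOff h₂ (by decide))
    ((h₂.var 10 (by decide)).trans hi) hj
  simp [Test.Holds, NatExpr.eval, hvar]

open Classical in
theorem exec_compareCode_var {x x' z : ℕ} {i k : Fin m} (h : HasInput S s) (hi : s.var x = i)
    (hk : s.var x' = k) (hwf : (compareCode x x' z).wf) (hz : z ≠ 12)
    (hx : .var x ∉ (compareCode x x' z).writes) (hx' : .var x' ∉ (compareCode x x' z).writes) :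
    ((compareCode x x' z).exec s).var z = if zeroSet S i ⊆ zeroSet S k then 0 else 1 := by
  have hP := exec_existsFor_var (P := fun j => j ∈ zeroSet S i ∧ j ∉ zeroSet S k) hwf
    (by simpa [writes] using hz) h.cols fun j s₁ hj h₁ => by
      have h' := h.of_sameOff h₁ ⟨fun h₀ => by simpa using two_le_of_var_mem_writes hwf h₀,
        fun h₀ => by simpa using two_le_of_var_mem_writes hwf h₀, by simp [existsFor, writes]⟩
      simp [Test.Holds, exec, isZero, entry, RealExpr.eval, NatExpr.eval, (h₁.var x hx).trans hi,
        (h₁.var x' hx').trans hk, hj, h'.real_eq, zeroSet]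
  rw [compareCode, hP]
  by_cases hsub : zeroSet S i ⊆ zeroSet S k <;> simp [← Set.not_subset, hsub]

open Classical in
theorem exec_largerCode_var {i : Fin m} (h : HasInput S s)
    (hN : s.natVec 0 m = fun i => if NonconstRow S i then 1 else 0) (hi : s.var 10 = i) :
    (largerCode.exec s).var 23 =
      if ∃ k, NonconstRow S k ∧ zeroSet S i ⊂ zeroSet S k then 1 else 0 := by
  rw [largerCode]
  refine exec_existsFor_var (by decide) (by decide) h.rows fun k s₁ hk h₁ => ?_
  have hs := sameOff_exec (compareCode 10 11 21) s₁
  have hs' := sameOff_exec (compareCode 11 10 22) ((compareCode 10 11 21).exec s₁)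
  replace hi := (h₁.var 10 (by decide)).trans hi
  replace h := h.of_sameOff h₁ (by decide)
  have h21 := exec_compareCode_var h hi hk (z := 21) (by decide) (by decide) (by decide)
    (by decide)
  have h22 := exec_compareCode_var (h.of_sameOff hs (by decide))
    ((hs.var 11 (by decide)).trans hk) ((hs.var 10 (by decide)).trans hi) (z := 22) (by decide)
    (by decide) (by decide) (by decide)
  have hmark : s₁.nat 0 k 0 = if NonconstRow S k then 1 else 0 :=
    (congrFun (h₁.natVec_eq (by decide) m) k).trans (congrFun hN k)
  simp [Test.Holds, exec, natItem, NatExpr.eval, hs'.var 21 (by decide), hs'.var 11 (by decide),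
    hs.var 11 (by decide), hs'.nat 0 (by decide), hs.nat 0 (by decide), h21, h22, hk, hmark,
    ssubset_iff_subset_not_subset]

open Classical in
theorem natVec_exec_facetCode (h : HasInput S s)
    (hN : s.natVec 0 m = fun i => if NonconstRow S i then 1 else 0) :
    (facetCode.exec s).natVec 1 m = fun i => if IsFacetRow S i then 1 else 0 := by
  refine natVec_exec_mapNat (by decide) (by decide) h.rows fun i s₁ hi h₁ _ => ?_
  have hN' := (h₁.natVec_eq (by decide) m).trans hN
  have hs := sameOff_exec largerCode s₁
  have hmark := congrFun ((hs.natVec_eq (by decide) m).trans hN') i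
  have hfacet : IsFacetRow S i ↔
      NonconstRow S i ∧ ¬ ∃ k, NonconstRow S k ∧ zeroSet S i ⊂ zeroSet S k := by
    simp only [IsFacetRow, maximalFor_iff_forall_gt, not_exists, not_and]
    exact and_congr_right fun _ => forall_congr' fun _ => imp_not_comm
  rw [Store.natVec] at hmark
  simp only [natItem, NatExpr.eval, hs.var 10 (by decide), hi, hmark, hfacet,
    exec_largerCode_var (h.of_sameOff h₁ (by decide)) hN' hi]
  split_ifs <;> simp_all

open Classical in
theorem matrix_exec_copyCode {b : Test} {a : ℕ} {Y : Set (Fin m)} (h : HasInput S s)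
    (ha : a ≠ 0) (ha' : a ≠ 7)
    (hb : ∀ (i : Fin m) (s' : Store), s'.var 10 = i → SameOff (copyCode b a).writes s s' →
      (b.Holds s' ↔ i ∈ Y)) :
    ((copyCode b a).exec s).matrix a m n = rowsIn S Y := by
  refine matrix_exec_mapReal₂ rfl (by simpa [writes] using ha') h.rows h.cols
    fun i j s₁ hi hj h₁ _ => ?_
  have h' := h.of_sameOff h₁ (by simp [mapReal₂, writes, ha.symm])
  have hbi := hb i s₁ hi h₁
  by_cases hY : i ∈ Y
  · simp [exec, hbi, Store.setReal, entry, RealExpr.eval, NatExpr.eval, hi, hj, h'.real_eq, rowsIn,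
      hY]
  · simp [exec, hbi, Store.setReal, RealExpr.eval, NatExpr.eval, rowsIn, hY]

theorem matrix_exec_zeroCode (hm : s.var 0 = m) : (zeroCode.exec s).matrix 4 m m = 0 :=
  matrix_exec_mapReal₂ rfl (by decide) hm hm fun _ _ _ _ _ _ _ => by
    simp [RealExpr.eval]

section Projection

variable {M : Matrix (Fin m) (Fin n) ℝ} {Q : Matrix (Fin m) (Fin m) ℝ} {w : Fin m → ℝ} {j : Fin n}

theorem eval_diffEntry (hM : s.matrix 3 m n = M) (hj : s.var 13 = j) {x : ℕ} {i : Fin m}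
    (hx : s.var x = i) : (diffEntry x).eval s = (M.col j - M.col ⟨0, j.pos⟩) i := by
  subst hM
  simp [diffEntry, entry, realItem, RealExpr.eval, NatExpr.eval, hj, hx, Store.matrix]

theorem realVec_exec_residualCode (hm : s.var 0 = m) (hM : s.matrix 3 m n = M)
    (hQ : s.matrix 4 m m = Q) (hj : s.var 13 = j) :
    (residualCode.exec s).realVec 5 m =
      M.col j - M.col ⟨0, j.pos⟩ - Q *ᵥ (M.col j - M.col ⟨0, j.pos⟩) := by
  refine realVec_exec_mapReal rfl (by decide) hm fun i s₁ hi h₁ => ?_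
  have hM₁ := (h₁.matrix_eq (by decide) m n).trans hM
  have hj₁ := (h₁.var 13 (by decide)).trans hj
  have hs := sameOff_exec (sumFor 12 0 6 (.mul (entry 4 10 12) (diffEntry 12))) s₁
  have hsum := exec_sumFor_real (s := s₁) (x := 12) (a := 6) (y := 0)
    (e := .mul (entry 4 10 12) (diffEntry 12))
    (V := fun k => Q i k * (M.col j - M.col ⟨0, j.pos⟩) k)
    (by decide) ((h₁.var 0 (by decide)).trans hm) fun k s₂ hk h₂ => by
      have hQ₂ := congrFun₂ ((h₂.matrix_eq (by decide) m m).trans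
        ((h₁.matrix_eq (by decide) m m).trans hQ)) i k
      rw [RealExpr.eval, eval_diffEntry ((h₂.matrix_eq (by decide) m n).trans hM₁)
        ((h₂.var 13 (by decide)).trans hj₁) hk, ← hQ₂]
      simp [entry, RealExpr.eval, NatExpr.eval, h₂.var 10 (by decide), hi, hk, Store.matrix]
  rw [RealExpr.eval, eval_diffEntry ((hs.matrix_eq (by decide) m n).trans hM₁)
    ((hs.var 13 (by decide)).trans hj₁) ((hs.var 10 (by decide)).trans hi)]
  exact congrArg _ hsum

theorem matrix_exec_updateCode (hm : s.var 0 = m) (hQ : s.matrix 4 m m = Q)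
    (hw : s.realVec 5 m = w) :
    (updateCode.exec s).matrix 4 m m = Q + (w ⬝ᵥ w)⁻¹ • vecMulVec w w := by
  subst hw
  rw [updateCode, exec]
  have hs := sameOff_exec (sumFor 10 0 6 (.mul (realItem 5 10) (realItem 5 10))) s
  have hsum := exec_sumFor_real (s := s) (x := 10) (a := 6) (y := 0)
    (e := .mul (realItem 5 10) (realItem 5 10)) (V := fun i => s.realVec 5 m i * s.realVec 5 m i)
    (by decide) hm fun i s₁ hi h₁ => by
      simp [realItem, RealExpr.eval, NatExpr.eval, hi, h₁.real 5 (by decide), realVec]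
  set s' := (sumFor 10 0 6 (.mul (realItem 5 10) (realItem 5 10))).exec s
  have hm₁ := (hs.var 0 (by decide)).trans hm
  refine matrix_exec_mapReal₂ rfl (by decide) hm₁ hm₁ fun i k s₂ hi hk h₂ h4 => ?_
  have hQik : s.real 4 i k = Q i k := congrFun₂ hQ i k
  simp [exec, entry, realItem, RealExpr.eval, NatExpr.eval, hi, hk, h4, hs.real 4 (by decide),
    hQik, h₂.real 5 (by decide), h₂.real 6 (by decide), hs.real 5 (by decide), hsum,
    vecMulVec_apply, realVec, dotProduct, div_eq_inv_mul]

theorem vectorSpan_range_eq_span_range_sub (v : Fin n → Fin m → ℝ) :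
    vectorSpan ℝ (Set.range v) =
      Submodule.span ℝ (Set.range fun j : Fin n => v j - v ⟨0, j.pos⟩) := by
  rcases n with _ | n
  · simp
  · exact vectorSpan_range_eq_span_range_vsub_right ℝ v 0

theorem isProjectionMatrix_exec_projCode (hm : s.var 0 = m) (hn : s.var 1 = n)
    (hM : s.matrix 3 m n = M) :
    IsProjectionMatrix ((projCode.exec s).matrix 4 m m) (vectorSpan ℝ (Set.range M.col)) := by
  have hs := sameOff_exec zeroCode s
  have h := exec_forTo (x := 13) (y := 1) (c := .seq residualCode updateCode) (by decide)
    ((hs.var 1 (by decide)).trans hn)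
    (fun A s' => IsProjectionMatrix (s'.matrix 4 m m)
      (Submodule.span ℝ ((fun j : Fin n => M.col j - M.col ⟨0, j.pos⟩) '' A)))
    (by simpa [matrix_exec_zeroCode hm] using isProjectionMatrix_zero_bot)
    (fun _ _ _ h => h) fun A j _ s₁ hj h₁ hI => ?_
  · rwa [Finset.coe_univ, Set.image_univ, ← vectorSpan_range_eq_span_range_sub] at h
  · have hm₁ := (h₁.var 0 (by decide)).trans ((hs.var 0 (by decide)).trans hm)
    have hres := sameOff_exec residualCode s₁
    have hw := realVec_exec_residualCode hm₁ ((h₁.matrix_eq (by decide) m n).trans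
      ((hs.matrix_eq (by decide) m n).trans hM)) rfl hj
    rw [Finset.coe_insert, Set.image_insert_eq, Submodule.span_insert, sup_comm, exec,
      matrix_exec_updateCode ((hres.var 0 (by decide)).trans hm₁)
      (hres.matrix_eq (by decide) m m) hw]
    exact hI.add_vecMulVec rfl

end Projection

section Components

theorem isComponentLabelling_exec_initCode (hm : s.var 0 = m) :
    IsComponentLabelling (fun _ _ => False) ((initCode.exec s).natVec 2 m) := by
  have h : (initCode.exec s).natVec 2 m = fun i : Fin m => (i : ℕ) :=
    natVec_exec_mapNat rfl (by decide) hm fun i s₁ hi _ _ => by simp [exec, NatExpr.eval, hi]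
  exact h ▸ isComponentLabelling_of_injective Fin.val_injective

theorem natVec_exec_joinCode {κ : Fin m → ℕ} {i j : Fin m} (hm : s.var 0 = m)
    (hκ : s.natVec 2 m = κ) (hi : s.var 10 = i) (hj : s.var 11 = j) :
    (joinCode.exec s).natVec 2 m = mergeLabels κ i j := by
  have hκk : ∀ k : Fin m, s.nat 2 k 0 = κ k := congrFun hκ
  set s₂ := (s.setVar 24 (κ i)).setVar 25 (κ j)
  have h24 : s₂.var 24 = κ i := rfl
  have h25 : s₂.var 25 = κ j := rfl
  have hexec : joinCode.exec s = (mapNat 12 0 (.ite (.natEq (natItem 2 12) (.var 24))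
      (.setVar 26 (.var 25)) (.setVar 26 (natItem 2 12))) 2 (.var 26)).exec s₂ := by
    simp [joinCode, exec, natItem, NatExpr.eval, setVar_var_of_ne, hi, hj, hκk, s₂]
  rw [hexec]
  refine natVec_exec_mapNat (by decide) (by decide) hm fun k s₃ hk h₃ h2 => ?_
  have h2k : s₃.nat 2 k 0 = κ k := h2.trans (hκk k)
  by_cases hki : κ k = κ i
  · simp [exec, Test.Holds, natItem, NatExpr.eval, hk, h2k, hki, h₃.var 24 (by decide), h24,
      h₃.var 25 (by decide), h25, mergeLabels]
  · simp [exec, Test.Holds, natItem, NatExpr.eval, hk, h2k, hki, h₃.var 24 (by decide), h24,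
      mergeLabels]

theorem isComponentLabelling_exec_compCode {Q : Matrix (Fin m) (Fin m) ℝ} (hm : s.var 0 = m)
    (hQ : s.matrix 4 m m = Q) :
    IsComponentLabelling (fun i j => Q i j ≠ 0) ((compCode.exec s).natVec 2 m) := by
  rw [compCode, exec]
  have hs := sameOff_exec initCode s
  have hm₁ := (hs.var 0 (by decide)).trans hm
  have h := exec_forTo_forTo (x := 10) (y := 0) (x' := 11) (y' := 0)
    (c := .ite (.not (isZero 4 10 11)) joinCode .skip) (by decide) hm₁ hm₁
    (fun A s' => IsComponentLabelling (fun i j => (i, j) ∈ A ∧ Q i j ≠ 0) (s'.natVec 2 m))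
    (by simpa using isComponentLabelling_exec_initCode hm) (fun _ _ _ _ h => h)
    fun A ⟨i, j⟩ _ s₁ hi hj h₁ hI => ?_
  · simpa only [Finset.mem_univ, true_and] using h
  · have hQij : s₁.real 4 i j = Q i j :=
      congrFun₂ ((h₁.matrix_eq (by decide) m m).trans ((hs.matrix_eq (by decide) m m).trans hQ)) i j
    by_cases h0 : Q i j = 0
    · convert hI using 3
      · grind
      · simp [exec, Test.Holds, isZero, entry, RealExpr.eval, NatExpr.eval, hi, hj, hQij, h0]
    · have hmerge := hI.mergeLabels (R' := fun i' j' => (i', j') ∈ insert (i, j) A ∧ Q i' j' ≠ 0)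
        (a := i) (b := j) (by grind)
      convert hmerge using 1
      rw [← natVec_exec_joinCode ((h₁.var 0 (by decide)).trans hm₁) rfl hi hj]
      simp [exec, Test.Holds, isZero, entry, RealExpr.eval, NatExpr.eval, hi, hj, hQij, h0]

end Components

theorem hasComponents_exec_separateCode (h : HasInput S s) :
    HasComponents S (separateCode.exec s) := by
  classical
  have hs₁ := sameOff_exec nonconstCode s
  have h₁ := h.of_sameOff hs₁ (by decide)
  have hN := natVec_exec_nonconstCode h
  set s₁ := nonconstCode.exec s
  have hs₂ := sameOff_exec facetCode s₁
  have h₂ := h₁.of_sameOff hs₂ (by decide)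
  have hF : ∀ i : Fin m, (facetCode.exec s₁).nat 1 i 0 = 1 ↔ IsFacetRow S i := fun i => by
    rw [show (facetCode.exec s₁).nat 1 i 0 = _ from congrFun (natVec_exec_facetCode h₁ hN) i]
    simp
  set s₂ := facetCode.exec s₁
  have hs₃ := sameOff_exec (copyCode facetTest 3) s₂
  have h₃ := h₂.of_sameOff hs₃ (by decide)
  have hM : ((copyCode facetTest 3).exec s₂).matrix 3 m n = rowsIn S (facetRows S) :=
    matrix_exec_copyCode h₂ (by decide) (by decide) fun i s' hi hs' => by
      simp [facetTest, Test.Holds, natItem, NatExpr.eval, hi, hs'.nat 1 (by decide), hF, facetRows]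
  set s₃ := (copyCode facetTest 3).exec s₂
  have hs₄ := sameOff_exec projCode s₃
  have h₄ := h₃.of_sameOff hs₄ (by decide)
  have hQ := isProjectionMatrix_exec_projCode h₃.rows h₃.cols hM
  set s₄ := projCode.exec s₃
  have hs₅ := sameOff_exec compCode s₄
  have hκ := isComponentLabelling_exec_compCode h₄.rows rfl
  refine ⟨h₄.of_sameOff hs₅ (by decide), fun i => ?_, fun X =>
    hQ.isSeparator_iff_of_isComponentLabelling hκ⟩
  rw [← hF, show separateCode.exec s = compCode.exec s₄ from rfl, hs₅.nat 1 (by decide),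
    hs₄.nat 1 (by decide), hs₃.nat 1 (by decide)]

section Output

theorem holds_facetTest {i : Fin m} (h : HasComponents S s) (hi : s.var 10 = i) :
    facetTest.Holds s ↔ IsFacetRow S i := by
  simp [facetTest, Test.Holds, natItem, NatExpr.eval, hi, h.mark_iff]

theorem holds_insideTest {i : Fin m} (h : HasComponents S s) (hi : s.var 10 = i) :
    insideTest.Holds s ↔ i ∈ facetRows S ∩ s.factorRows m := by
  simp [insideTest, Test.Holds, natItem, NatExpr.eval, holds_facetTest h hi, hi, natVec, facetRows,
    factorRows]

theorem holds_outsideTest {i : Fin m} (h : HasComponents S s) (hi : s.var 10 = i) :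
    outsideTest.Holds s ↔ i ∈ facetRows S ∩ (s.factorRows m)ᶜ := by
  simp [outsideTest, Test.Holds, natItem, NatExpr.eval, holds_facetTest h hi, hi, natVec, facetRows,
    factorRows]

theorem exists_mem_factorRows_exec_pickCode (h : HasComponents S s) (hF : ∃ i, IsFacetRow S i) :
    ∃ i ∈ (pickCode.exec s).factorRows m, IsFacetRow S i := by
  have hpick := exec_forTo (x := 10) (y := 0)
    (c := .ite facetTest (.setVar 27 (natItem 2 10)) .skip) (by decide) h.rows
    (fun A s' => (∃ i ∈ A, IsFacetRow S i) → ∃ i ∈ s'.factorRows m, IsFacetRow S i)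
    (by simp) (fun _ _ _ hI => hI) fun A i _ s₁ hi hs hI hA => ?_
  · obtain ⟨i, hi⟩ := hF
    exact hpick ⟨i, Finset.mem_univ i, hi⟩
  · have htest := holds_facetTest (h.of_sameOff hs (by decide) (by decide)) hi
    by_cases hFi : IsFacetRow S i
    · refine ⟨i, ?_, hFi⟩
      simp [exec, htest, hFi, natItem, NatExpr.eval, hi, natVec, factorRows]
    · have hA' : ∃ i ∈ A, IsFacetRow S i := by simpa [hFi] using hA
      simpa [exec, htest, hFi] using hI hA'

open Classical in
theorem exec_answerCode_var (h : HasComponents S s) :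
    (answerCode.exec s).var 28 = if ∃ i ∉ s.factorRows m, IsFacetRow S i then 1 else 0 := by
  rw [answerCode]
  refine exec_existsFor_var (by decide) (by decide) h.rows fun i s₁ hi hs => ?_
  rw [exec, holds_outsideTest (h.of_sameOff hs (by decide) (by decide)) hi,
    hs.factorRows_eq (by decide)]
  exact and_comm

theorem matrix_exec_copyCode_insideTest (h : HasComponents S s) :
    ((copyCode insideTest 1).exec s).matrix 1 m n = rowsIn S (facetRows S ∩ s.factorRows m) :=
  matrix_exec_copyCode h.toHasInput (by decide) (by decide) fun i s' hi hs => by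
    rw [holds_insideTest (h.of_sameOff hs (by decide) (by decide)) hi,
      hs.factorRows_eq (by decide)]

theorem matrix_exec_copyCode_outsideTest (h : HasComponents S s) :
    ((copyCode outsideTest 2).exec s).matrix 2 m n =
      rowsIn S (facetRows S ∩ (s.factorRows m)ᶜ) :=
  matrix_exec_copyCode h.toHasInput (by decide) (by decide) fun i s' hi hs => by
    rw [holds_outsideTest (h.of_sameOff hs (by decide) (by decide)) hi,
      hs.factorRows_eq (by decide)]

open Classical in
theorem exec_outputCode (h : HasComponents S s) :
    (outputCode.exec s).var 28 =
        (if ∃ i ∉ (pickCode.exec s).factorRows m, IsFacetRow S i then 1 else 0) ∧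
      (outputCode.exec s).matrix 1 m n =
        rowsIn S (facetRows S ∩ (pickCode.exec s).factorRows m) ∧
      (outputCode.exec s).matrix 2 m n =
        rowsIn S (facetRows S ∩ ((pickCode.exec s).factorRows m)ᶜ) := by
  have h₁ := h.of_sameOff (sameOff_exec pickCode s) (by decide) (by decide)
  set s₁ := pickCode.exec s
  have hs₂ := sameOff_exec answerCode s₁
  have h₂ := h₁.of_sameOff hs₂ (by decide) (by decide)
  set s₂ := answerCode.exec s₁ with hs₂_def
  have hs₃ := sameOff_exec (copyCode insideTest 1) s₂
  have h₃ := h₂.of_sameOff hs₃ (by decide) (by decide)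
  have hX₂ := hs₂.factorRows_eq (by decide) m
  have hX₃ := (hs₃.factorRows_eq (by decide) m).trans hX₂
  have hout₁ := matrix_exec_copyCode_insideTest h₂
  set s₃ := (copyCode insideTest 1).exec s₂
  have hs₄ := sameOff_exec (copyCode outsideTest 2) s₃
  have hout₂ := matrix_exec_copyCode_outsideTest h₃
  rw [show outputCode.exec s = (copyCode outsideTest 2).exec s₃ from rfl]
  refine ⟨?_, ?_, by rw [hout₂, hX₃]⟩
  · rw [hs₄.var 28 (by decide), hs₃.var 28 (by decide), hs₂_def, exec_answerCode_var h₁]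
  · rw [hs₄.matrix_eq (by decide), hout₁, hX₂]

theorem exec_mainCode_input (S : Matrix (Fin m) (Fin n) ℝ) {s : Store}
    (hs : mainCode.exec (input S) = s) :
    (s.var 28 = 1 ∧ ∃ X : Set (Fin m), IsSeparator (facetSpace S) X ∧
        (∃ i ∈ X, IsFacetRow S i) ∧ (∃ i ∉ X, IsFacetRow S i) ∧
        s.matrix 1 m n = rowsIn S (facetRows S ∩ X) ∧
        s.matrix 2 m n = rowsIn S (facetRows S ∩ Xᶜ)) ∨
      (s.var 28 = 0 ∧ ¬ ∃ X : Set (Fin m), IsSeparator (facetSpace S) X ∧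
        (∃ i ∈ X, IsFacetRow S i) ∧ ∃ i ∉ X, IsFacetRow S i) := by
  have h := hasComponents_exec_separateCode (hasInput_input S)
  obtain ⟨hans, hout₁, hout₂⟩ := exec_outputCode h
  rw [show outputCode.exec (separateCode.exec (input S)) = s from hs] at hans hout₁ hout₂
  have hpick := exists_mem_factorRows_exec_pickCode h
  replace h := h.of_sameOff (sameOff_exec pickCode _) (by decide) (by decide)
  by_cases hex : ∃ i ∉ (pickCode.exec (separateCode.exec (input S))).factorRows m, IsFacetRow S i
  · exact .inl ⟨by rw [hans, if_pos hex], _, h.isSeparator_factorRows,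
      hpick (hex.imp fun _ hi => hi.2), hex, hout₁, hout₂⟩
  · exact .inr ⟨by rw [hans, if_neg hex], fun ⟨X, hX, h₁, h₂⟩ =>
      hex (h.exists_notMem_factorRows hX h₁ h₂)⟩

end Output

end Code

/-- The program that moves the answer and the formats of the output matrices to their places. -/
def moveProgram : Program :=
  .seq (.setVar 2 (.var 1)) (.seq (.setVar 4 (.var 1)) (.seq (.setVar 3 (.var 0))
    (.seq (.setVar 1 (.var 0)) (.setVar 0 (.var 28)))))

theorem exists_runs_moveProgram {m n : ℕ} {s : Store} (hm : s.var 0 = m) (hn : s.var 1 = n) :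
    ∃ s', Runs moveProgram s s' 10 ∧ s'.answer = s.var 28 ∧ s'.outputSize = m * n + m * n ∧
      (∀ d (P : Set (Fin d → ℝ)), IsSlackMatrix (s.matrix 1 m n) P → IsSlackMatrix s'.output₁ P) ∧
      ∀ d (P : Set (Fin d → ℝ)), IsSlackMatrix (s.matrix 2 m n) P → IsSlackMatrix s'.output₂ P := by
  subst hm hn
  exact ⟨_, .seq (.setVar _ _ _) (.seq (.setVar _ _ _) (.seq (.setVar _ _ _)
    (.seq (.setVar _ _ _) (.setVar _ _ _)))), rfl, rfl, fun _ _ => id, fun _ _ => id⟩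

/-- The program of the theorem: the algorithm, followed by the move of its results. -/
def productProgram : Program := .seq Code.mainCode.toProgram moveProgram

/-- A bound for the number of steps of `productProgram` and for the size of its output. -/
noncomputable def productBound : MvPolynomial (Fin 2) ℕ :=
  Code.mainCode.bound + 10 + 2 * MvPolynomial.X 0 * MvPolynomial.X 1

theorem format_input {m n : ℕ} (S : Matrix (Fin m) (Fin n) ℝ) : (input S).format = ![m, n] := by
  ext y
  fin_cases y <;> rfl

theorem exists_runs_productProgram {m n : ℕ} (S : Matrix (Fin m) (Fin n) ℝ) {s : Store}
    (hs : Code.mainCode.exec (input S) = s) :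
    ∃ s' t, Runs productProgram (input S) s' t ∧ t ≤ MvPolynomial.eval ![m, n] productBound ∧
      s'.answer = s.var 28 ∧ s'.outputSize ≤ MvPolynomial.eval ![m, n] productBound ∧
      (∀ d (P : Set (Fin d → ℝ)), IsSlackMatrix (s.matrix 1 m n) P → IsSlackMatrix s'.output₁ P) ∧
      ∀ d (P : Set (Fin d → ℝ)), IsSlackMatrix (s.matrix 2 m n) P → IsSlackMatrix s'.output₂ P := by
  have hwf : Code.mainCode.wf := by decide
  have hformat : s.format = ![m, n] := by rw [← hs, Code.exec_format hwf, format_input]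
  obtain ⟨t, ht, hrun⟩ := Code.exists_runs_exec hwf (input S)
  obtain ⟨s', hrun', hans, hsize, hout₁, hout₂⟩ :=
    exists_runs_moveProgram (m := m) (n := n) (congrFun hformat 0) (congrFun hformat 1)
  rw [format_input] at ht
  have hbound : MvPolynomial.eval ![m, n] productBound =
      MvPolynomial.eval ![m, n] Code.mainCode.bound + 10 + 2 * m * n := by
    simp [productBound]
  rw [hs] at hrun
  refine ⟨s', _, .seq hrun hrun', ?_, hans, ?_, hout₁, hout₂⟩ <;> rw [hbound]
  · omega
  · rw [hsize]; linarith

end RealRAM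

theorem theorem2 :
    ∃ (c : RealRAM.Program) (p : MvPolynomial (Fin 2) ℕ),
      ∀ (m n d : ℕ) (S : Matrix (Fin m) (Fin n) ℝ) (P : Set (Fin d → ℝ)),
        IsSlackMatrix S P →
        ∃ (s : RealRAM.Store) (t : ℕ),
          RealRAM.Runs c (RealRAM.Store.input S) s t ∧
          t ≤ MvPolynomial.eval ![m, n] p ∧
          ((s.answer = 1 ∧
              s.outputSize ≤ MvPolynomial.eval ![m, n] p ∧
              ∃ (d₁ d₂ : ℕ) (P₁ : Set (Fin d₁ → ℝ)) (P₂ : Set (Fin d₂ → ℝ)),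
                IsProductOf P P₁ P₂ ∧
                IsSlackMatrix s.output₁ P₁ ∧ IsSlackMatrix s.output₂ P₂) ∨
            (s.answer = 0 ∧
              ¬ ∃ (d₁ d₂ : ℕ) (P₁ : Set (Fin d₁ → ℝ)) (P₂ : Set (Fin d₂ → ℝ)),
                IsProductOf P P₁ P₂)) := by
  refine ⟨RealRAM.productProgram, RealRAM.productBound, fun m n d S P h => ?_⟩
  obtain ⟨s, t, hrun, ht, hans, hsize, hout₁, hout₂⟩ := RealRAM.exists_runs_productProgram S rfl
  refine ⟨s, t, hrun, ht, ?_⟩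
  rcases RealRAM.Code.exec_mainCode_input S rfl with
    ⟨hyes, X, hX, h₁, h₂, hS₁, hS₂⟩ | ⟨hno, hX⟩
  · obtain ⟨d₁, d₂, P₁, P₂, hP, hP₁, hP₂⟩ := h.exists_isProductOf hX h₁ h₂
    exact .inl ⟨hans.trans hyes, hsize, d₁, d₂, P₁, P₂, hP, hout₁ d₁ P₁ (hS₁ ▸ hP₁),
      hout₂ d₂ P₂ (hS₂ ▸ hP₂)⟩
  · exact .inr ⟨hans.trans hno, fun ⟨_, _, _, _, hP⟩ => hX (h.exists_separator hP)⟩
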